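/- **Setting.** Let $X$ be a real Banach space with dual $X^*$, and write $\langle f,\varphi\rangle$ for the value of $f\in X^*$ at $\varphi\in X$. Let $M:X\to X^*$ be an acceleration operator, i.e. a bounded invertible linear operator that is Hermitian ($\langle M\varphi,\psi\rangle=\langle M\psi,\varphi\rangle$) and positive definite ($\langle M\varphi,\varphi\rangle>0$ for $\varphi\neq0$). (For a positive-definite self-adjoint operator $M$ in $L^2(\mathbb R^N;\mathbb R^K)$, $X$ is the energy space of $M$, and $\langle\cdot,\cdot\rangle$ extends the $L^2$ inner product; for a spatially discretized problem, $X=\mathbb R^d$.) Let $r\ge1$, $s\ge 0$, and consider $$L_0u\equiv L_{00}u-B(u)\vec\mu=0,\qquad Q_j(u)=C_j\quad(j=1,\dots,r),$$ with unknown $u\in X$ and $\vec\mu\in\mathbb R^r$, where $L_{00}:X\to X^*$, $B(u)=(B_1(u),\dots,B_r(u))$ with $B_j:X\to X^*$, $Q_j:X\to\mathbb R$ and $C_j\in\mathbb R$. Let $U(\vec\mu;c)\in X$, $c=(c_1,\dots,c_s)\in\mathbb R^s$, be a $C^1$ family of solutions of $L_0u=0$ defined for $(\vec\mu,c)$ near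 $(\vec\mu_0,c_0)$; let the solitary wave $u=U(\vec\mu_0;c_0)$ satisfy $Q_j(u)=C_j$ for all $j$, and let $L_{00}$, $B_j$, $Q_j$ be $C^2$ near $u$. Let $L_1$ be the derivative of $L_0$ at fixed $\vec\mu$ (taken at $(\vec\mu_0,u)$ unless said otherwise), $L_1^\dagger$ its adjoint, and $\delta Q_j/\delta u\in X^*$ the derivative of $Q_j$. For $h>0$ and a time step $\Delta t$, the quantity-conserving squared-operator method (QCSOM) is the iteration $$u_{n+1}=u_n-M^{-1}\Big[L_1^\dagger M^{-1}L_0u+h\sum_{j=1}^r(Q_j(u)-C_j)\frac{\delta Q_j}{\delta u}\Big]_{u=u_n,\ \vec\mu=\vec\mu_n}\Delta t,\qquad \vec\mu_n=\langle B,M^{-1}B\rangle^{-1}\langle B,M^{-1}L_{00}u\rangle\big|_{u=u_n},$$ where $L_1^\dagger$ is also taken at $u_n$, $\vec\mu_n$. Define the bounded operator $\mathcal L_{QC}$ on $X$, at the solitary wave $u$, $\vec\mu_0$, by $$\mathcal L_{QC}\Psi=M^{-1}\Big(-L_1^\dagger M^{-1}\big(L_1\Psi-B\langle B,M^{-1}B\rangle^{-1}\langle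 B,M^{-1}L_1\Psi\rangle\big)-h\sum_{j=1}^r\Big\langle\frac{\delta Q_j}{\delta u},\Psi\Big\rangle\frac{\delta Q_j}{\delta u}\Big).$$ **Theorem.** Assume that * the kernel of $L_1$ is spanned by the invariance modes $\partial U/\partial c_k$, $1\le k\le s$, at $(\vec\mu_0,c_0)$ (Assumption 1); * each $\delta Q_j/\delta u$ at $u$ is orthogonal to $\ker L_1$, i.e. $\langle\delta Q_j/\delta u,\psi\rangle=0$ for all $\psi\in\ker L_1$; * $\det\big(\partial Q_i(U)/\partial\mu_j\big)\ne0$ at $(\vec\mu_0,c_0)$. Then the spectrum of $\mathcal L_{QC}$ has a least element $\Lambda_{\min}$, and $\Lambda_{\min}<0$. Put $\Delta t_{\max}=-2/\Lambda_{\min}$. 1. Let $0<\Delta t<\Delta t_{\max}$. Then every solution of the linearized error iteration $\tilde u_{n+1}=(1+\Delta t\,\mathcal L_{QC})\tilde u_n$ converges to an element of $\ker L_1$. If, moreover, $0$ is not an accumulation point of the spectrum of $\mathcal L_{QC}$ (the nonzero part of the spectrum is bounded above by some $\Lambda_{\max}<0$), then QCSOM converges to the solitary wave, up to its invariances, whenever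 the initial condition is close to $u$: for every $\varepsilon>0$ there is $\delta>0$ such that for every $u_0$ with $\|u_0-u\|<\delta$ the iterates converge in $X$ to a member $U(\vec\mu;c)$ of the solution family with $\|(\vec\mu,c)-(\vec\mu_0,c_0)\|<\varepsilon$ which solves $L_{00}U-B(U)\vec\mu=0$ and satisfies $Q_j(U)=C_j$ for all $j$. 2. Let $\Delta t>\Delta t_{\max}$. Then QCSOM diverges from $u$: there is $\varepsilon>0$ such that arbitrarily close to $u$ there are initial conditions $u_0$ with $\|u_n-u\|\ge\varepsilon$ for some $n$. If, moreover, $\Lambda_{\min}$ is an isolated point of the spectrum, then for some $\varepsilon>0$ the set of initial conditions whose iterates all satisfy $\|u_n-u\|<\varepsilon$ has empty interior. -/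

import Mathlib

open Filter Topology Matrix

noncomputable section

/-!
Setting. `X` is the real Banach space in which the iteration runs and `StrongDual ℝ X` is its dual.
The evaluation `f φ` of `f : StrongDual ℝ X` at `φ : X` is the inner product `⟨f, φ⟩`.

The typical case: waves with values in `ℝ^K` on `ℝ^N`, and `M` a positive-definite self-adjoint
operator in `L²(ℝ^N; ℝ^K)`. Then `X` is the energy space of `M` (its form domain, with inner product
`⟨M φ, ψ⟩`), its dual contains `L²`, the evaluation extends the `L²` inner product, and `M` is an
isomorphism of `X` onto its dual. For `M = c - ∂ₓₓ` this is `H¹` with dual `H⁻¹`. A spatially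
discretized problem is the case `X = ℝ^d` with `M` a symmetric positive-definite matrix.
-/

namespace SolitaryWave

variable {X : Type*} [NormedAddCommGroup X] [NormedSpace ℝ X]

/-- An acceleration operator: an invertible, Hermitian and positive-definite operator. -/
structure AccelerationOperator (X : Type*) [NormedAddCommGroup X] [NormedSpace ℝ X] where
  /-- The operator `M`, as an isomorphism onto the dual. -/
  op : X ≃L[ℝ] StrongDual ℝ X
  hermitian : ∀ φ ψ : X, op φ ψ = op ψ φ
  posDef : ∀ φ : X, φ ≠ 0 → 0 < op φ φ

/-- The inverse `M⁻¹` of the acceleration operator. -/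
def AccelerationOperator.inv (M : AccelerationOperator X) : StrongDual ℝ X →L[ℝ] X :=
  (M.op.symm : StrongDual ℝ X →L[ℝ] X)

/-- The data of a wave equation `L₀₀ u - B(u) μ = 0` with `r` propagation constants
`μ = (μ₁, …, μᵣ)`, together with `r` functionals `Q₁, …, Qᵣ` and prescribed values `C₁, …, Cᵣ`. -/
structure ConstrainedEquation (X : Type*) [NormedAddCommGroup X] [NormedSpace ℝ X] (r : ℕ) where
  /-- The nonlinear operator `L₀₀`. -/
  L00 : X → StrongDual ℝ X
  /-- `B j u` is the `j`-th column of the matrix function `B(u)`. -/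
  B : Fin r → X → StrongDual ℝ X
  /-- The functionals `Qⱼ`. -/
  Q : Fin r → X → ℝ
  /-- The prescribed values `Cⱼ`. -/
  C : Fin r → ℝ

namespace ConstrainedEquation

variable {r : ℕ} (E : ConstrainedEquation X r) (M : AccelerationOperator X)

/-- `L₀ u = L₀₀ u - B(u) μ`. -/
def L0 (μ : Fin r → ℝ) (u : X) : StrongDual ℝ X :=
  E.L00 u - ∑ j, μ j • E.B j u

/-- The linearization `L₁` of `L₀` around `u`, with the propagation constants held fixed. -/
def L1 (μ : Fin r → ℝ) (u : X) : X →L[ℝ] StrongDual ℝ X :=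
  fderiv ℝ (E.L0 μ) u

/-- The Hermitian adjoint `L₁†`: `⟨L₁† φ, ψ⟩ = ⟨L₁ ψ, φ⟩`. -/
def L1adj (μ : Fin r → ℝ) (u : X) : X →L[ℝ] StrongDual ℝ X :=
  (E.L1 μ u).flip

/-- The functional derivative `δQⱼ/δu`. -/
def dQ (j : Fin r) (u : X) : StrongDual ℝ X :=
  fderiv ℝ (E.Q j) u

/-- The `r × r` matrix `⟨B, M⁻¹ B⟩` at `u`. -/
def gram (u : X) : Matrix (Fin r) (Fin r) ℝ :=
  Matrix.of fun i j => E.B i u (M.inv (E.B j u))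

/-- The vector `⟨B, M⁻¹ B⟩⁻¹ ⟨B, M⁻¹ f⟩` at `u`. -/
def coeff (u : X) (f : StrongDual ℝ X) : Fin r → ℝ :=
  (E.gram M u)⁻¹ *ᵥ fun i => E.B i u (M.inv f)

/-- The propagation constants assigned to an iterate:
`μ(u) = ⟨B, M⁻¹ B⟩⁻¹ ⟨B, M⁻¹ L₀₀ u⟩`. -/
def mu (u : X) : Fin r → ℝ :=
  E.coeff M u (E.L00 u)

/-- One step of the quantity-conserving squared-operator method:
`u ↦ u - M⁻¹ [L₁† M⁻¹ L₀ u + h ∑ⱼ (Qⱼ(u) - Cⱼ) δQⱼ/δu] Δt`, where `L₀` and `L₁` are taken at the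
propagation constants `μ(u)` and `L₁` is the linearization around the current iterate `u`. -/
def step (h dt : ℝ) (u : X) : X :=
  u - dt • M.inv (E.L1adj (E.mu M u) u (M.inv (E.L0 (E.mu M u) u)) +
    h • ∑ j, (E.Q j u - E.C j) • E.dQ j u)

/-- The bounded operator `f ↦ B ⟨B, M⁻¹ B⟩⁻¹ ⟨B, M⁻¹ f⟩`. -/
def projB (u : X) : StrongDual ℝ X →L[ℝ] StrongDual ℝ X :=
  ∑ i, ∑ j, (E.gram M u)⁻¹ i j • ((E.B j u).comp M.inv).smulRight (E.B i u)

theorem projB_apply (u : X) (f : StrongDual ℝ X) :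
    E.projB M u f = ∑ i, E.coeff M u f i • E.B i u := by
  ext φ
  simp [projB, coeff, Matrix.mulVec, dotProduct, Finset.sum_mul, mul_assoc]

/-- `L̂ Ψ = - L₁† M⁻¹ (L₁ Ψ - B ⟨B, M⁻¹ B⟩⁻¹ ⟨B, M⁻¹ L₁ Ψ⟩)`. -/
def LPCG (μ : Fin r → ℝ) (u : X) : X →L[ℝ] StrongDual ℝ X :=
  -((E.L1adj μ u).comp (M.inv.comp (E.L1 μ u - (E.projB M u).comp (E.L1 μ u))))

/-- `𝓛_QC Ψ = M⁻¹ (L̂ Ψ - h ∑ⱼ ⟨δQⱼ/δu, Ψ⟩ δQⱼ/δu)`. -/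
def LQC (h : ℝ) (μ : Fin r → ℝ) (u : X) : X →L[ℝ] X :=
  M.inv.comp (E.LPCG M μ u - h • ∑ j, (E.dQ j u).smulRight (E.dQ j u))

theorem LQC_apply (h : ℝ) (μ : Fin r → ℝ) (u ψ : X) :
    E.LQC M h μ u ψ =
      M.inv (-(E.L1adj μ u (M.inv (E.L1 μ u ψ - ∑ i, E.coeff M u (E.L1 μ u ψ) i • E.B i u))) -
        h • ∑ j, (E.dQ j u ψ) • E.dQ j u) := by
  simp [LQC, LPCG, projB_apply]

/-- `U(μ; c)` is near `(μ₀, c₀)` a continuously differentiable family of solutions of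
`L₀₀ u - B(u) μ = 0`, with free parameters `c = (c₁, …, cₛ)`. -/
def IsSolutionFamily {s : ℕ} (U : (Fin r → ℝ) × (Fin s → ℝ) → X)
    (μ₀ : Fin r → ℝ) (c₀ : Fin s → ℝ) : Prop :=
  ContDiffAt ℝ 1 U (μ₀, c₀) ∧ ∀ᶠ p in 𝓝 (μ₀, c₀), E.L0 p.1 (U p) = 0

/-- The kernel of `L₁` at the solution `U(μ₀; c₀)` consists of the invariance modes
`∂U/∂c₁, …, ∂U/∂cₛ` and their linear combinations only. -/
def KernelIsInvarianceModes {s : ℕ} (U : (Fin r → ℝ) × (Fin s → ℝ) → X)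
    (μ₀ : Fin r → ℝ) (c₀ : Fin s → ℝ) : Prop :=
  (E.L1 μ₀ (U (μ₀, c₀))).ker =
    Submodule.span ℝ (Set.range fun k : Fin s => fderiv ℝ U (μ₀, c₀) (0, Pi.single k 1))

/-- The matrix `(∂Qᵢ/∂μⱼ)` along the solution family, at `(μ₀, c₀)`. -/
def dQdmu {s : ℕ} (U : (Fin r → ℝ) × (Fin s → ℝ) → X)
    (μ₀ : Fin r → ℝ) (c₀ : Fin s → ℝ) : Matrix (Fin r) (Fin r) ℝ :=
  Matrix.of fun i j => fderiv ℝ (fun p => E.Q i (U p)) (μ₀, c₀) (Pi.single j 1, 0)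

/-- Local convergence: iterates that start close enough to `U(μ₀; c₀)` converge to a member
`U(μ; c)` of the solution family, with `(μ, c)` as close to `(μ₀, c₀)` as desired, which solves the
equation and satisfies all constraints. -/
def ConvergesNear {s : ℕ} (h dt : ℝ) (U : (Fin r → ℝ) × (Fin s → ℝ) → X)
    (μ₀ : Fin r → ℝ) (c₀ : Fin s → ℝ) : Prop :=
  ∀ ε > 0, ∃ δ > 0, ∀ u₀ : X, ‖u₀ - U (μ₀, c₀)‖ < δ →
    ∃ p : (Fin r → ℝ) × (Fin s → ℝ), ‖p - (μ₀, c₀)‖ < ε ∧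
      E.L0 p.1 (U p) = 0 ∧ (∀ j, E.Q j (U p) = E.C j) ∧
      Tendsto (fun n : ℕ => (E.step M h dt)^[n] u₀) atTop (𝓝 (U p))

/-- Divergence: some fixed neighbourhood of `u` is left by iterates that start arbitrarily close
to `u`. -/
def DivergesFrom (h dt : ℝ) (u : X) : Prop :=
  ∃ ε > 0, ∀ δ > 0, ∃ u₀ : X, ‖u₀ - u‖ < δ ∧ ∃ n : ℕ, ε ≤ ‖(E.step M h dt)^[n] u₀ - u‖

/-- Generic divergence: the initial conditions whose iterates all stay in some fixed neighbourhood
of `u` form a set with empty interior. -/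
def DivergesGenericallyFrom (h dt : ℝ) (u : X) : Prop :=
  ∃ ε > 0, interior {u₀ : X | ∀ n : ℕ, ‖(E.step M h dt)^[n] u₀ - u‖ < ε} = ∅

end ConstrainedEquation

end SolitaryWave

end

/-!
In the energy space of `M`, with inner product `⟨M φ, ψ⟩`, the operator `𝓛_QC` is self-adjoint and
nonpositive with kernel `ker L₁`, and `1 + Δt 𝓛_QC` is the derivative at `u` of one step of the
method. The step is `C¹` with a quadratic remainder although it involves derivatives of the `C²`
data, because these derivatives only enter multiplied by residuals that vanish at `u`.

For `Δt < Δt_max`, powers of `1 + Δt 𝓛_QC` converge strongly to the projection onto the kernel, and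
a spectral gap makes `1 + Δt 𝓛_QC` a contraction of `(ker L₁)ᗮ`. By the implicit function theorem
every point near `u` differs by an element of `(ker L₁)ᗮ` from a member of the solution family that
satisfies the constraints, which is a fixed point; so the displacements `F x - x` decay
geometrically along iterates and the iterates converge.

For `Δt > Δt_max`, `S = 1 + Δt 𝓛_QC` satisfies `‖Sⁿ‖ = ‖S‖ⁿ` with `‖S‖ > 1`, which beats the
quadratic remainder until the iterates have left a fixed ball. If `Λ_min` is isolated, its
eigenspace dominates its complement: the cone around it is preserved and stretched, so no two
points of a segment in that direction stay near `u` for ever.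
-/

noncomputable section

namespace SolitaryWave

/-! ### Positive and self-adjoint operators -/

section Spectral

open scoped RealInnerProductSpace

variable {H : Type*} [NormedAddCommGroup H] [InnerProductSpace ℝ H] {T : H →L[ℝ] H}

theorem norm_map_pow_four_le_of_isPositive (hT : T.IsPositive) (x : H) :
    ‖T x‖ ^ 4 ≤ ⟪T x, x⟫ * ⟪T (T x), T x⟫ := by
  have hBsymm : (((innerₗ H).comp (T : H →ₗ[ℝ] H)) : LinearMap.BilinForm ℝ H).IsSymm :=
    ⟨fun x y => by simpa [real_inner_comm] using hT.inner_left_eq_inner_right x y⟩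
  have hCS := LinearMap.BilinForm.apply_sq_le_of_symm _ hT.inner_nonneg_left hBsymm x (T x)
  simpa [real_inner_self_eq_norm_sq, ← pow_mul] using hCS

theorem norm_map_sq_le_of_isPositive (hT : T.IsPositive) {c : ℝ}
    (hc : ∀ x, ⟪T x, x⟫ ≤ c * ‖x‖ ^ 2) (x : H) : ‖T x‖ ^ 2 ≤ c * ⟪T x, x⟫ := by
  rcases eq_or_ne (T x) 0 with hx | hx
  · simp [hx]
  · refine le_of_mul_le_mul_right ?_ (pow_pos (norm_pos_iff.2 hx) 2)
    calc ‖T x‖ ^ 2 * ‖T x‖ ^ 2 = ‖T x‖ ^ 4 := by ring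
      _ ≤ ⟪T x, x⟫ * ⟪T (T x), T x⟫ := norm_map_pow_four_le_of_isPositive hT x
      _ ≤ ⟪T x, x⟫ * (c * ‖T x‖ ^ 2) :=
        mul_le_mul_of_nonneg_left (hc (T x)) (hT.inner_nonneg_left x)
      _ = c * ⟪T x, x⟫ * ‖T x‖ ^ 2 := by ring

theorem norm_one_sub_map_sq_le (hT : T.IsPositive) {c : ℝ}
    (hc : ∀ x, ⟪T x, x⟫ ≤ c * ‖x‖ ^ 2) (x : H) :
    ‖(1 - T) x‖ ^ 2 ≤ ‖x‖ ^ 2 - (2 - c) * ⟪T x, x⟫ := by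
  rw [_root_.sub_apply, one_apply_eq_self, norm_sub_sq_real, real_inner_comm]
  linarith [norm_map_sq_le_of_isPositive hT hc x]

theorem norm_one_sub_map_le (hT : T.IsPositive) {c : ℝ} (hc2 : c < 2)
    (hc : ∀ x, ⟪T x, x⟫ ≤ c * ‖x‖ ^ 2) (x : H) : ‖(1 - T) x‖ ≤ ‖x‖ := by
  refine (sq_le_sq₀ (norm_nonneg _) (norm_nonneg x)).1 ?_
  linarith [norm_one_sub_map_sq_le hT hc x, mul_nonneg (sub_pos.2 hc2).le (hT.inner_nonneg_left x)]

theorem tendsto_map_one_sub_pow (hT : T.IsPositive) {c : ℝ} (hc2 : c < 2)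
    (hc : ∀ x, ⟪T x, x⟫ ≤ c * ‖x‖ ^ 2) (w : H) :
    Tendsto (fun n : ℕ => T (((1 - T) ^ n) w)) atTop (𝓝 0) := by
  set x : ℕ → H := fun n => ((1 - T) ^ n) w
  have hx (n : ℕ) : x (n + 1) = (1 - T) (x n) := by
    simp only [x, pow_succ', mul_apply_eq_comp]
  have hanti : Antitone fun n => ‖x n‖ ^ 2 := antitone_nat_of_succ_le fun n => by
    rw [hx]; gcongr; exact norm_one_sub_map_le hT hc2 hc _
  obtain ⟨a, ha⟩ : ∃ a, Tendsto (fun n => ‖x n‖ ^ 2) atTop (𝓝 a) :=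
    ⟨_, tendsto_atTop_ciInf hanti ⟨0, by rintro _ ⟨n, rfl⟩; positivity⟩⟩
  have hdiff : Tendsto (fun n => (‖x n‖ ^ 2 - ‖x (n + 1)‖ ^ 2) / (2 - c)) atTop (𝓝 0) := by
    simpa using (ha.sub (ha.comp (tendsto_add_atTop_nat 1))).div_const (2 - c)
  have henergy : Tendsto (fun n => ⟪T (x n), x n⟫) atTop (𝓝 0) :=
    squeeze_zero (fun n => hT.inner_nonneg_left _) (fun n => by
      rw [le_div_iff₀ (sub_pos.2 hc2), hx]
      linarith [norm_one_sub_map_sq_le hT hc (x n)]) hdiff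
  have hsq : Tendsto (fun n => ‖T (x n)‖ ^ 2) atTop (𝓝 0) :=
    squeeze_zero (fun n => sq_nonneg _) (fun n => norm_map_sq_le_of_isPositive hT hc (x n))
      (by simpa using henergy.const_mul c)
  refine tendsto_zero_iff_norm_tendsto_zero.2 ?_
  simpa only [Real.sqrt_sq (norm_nonneg _), Real.sqrt_zero] using hsq.sqrt

variable [CompleteSpace H]

theorem norm_le_of_forall_abs_spectrum_le (hT : IsSelfAdjoint T) {c : ℝ} (hc : 0 ≤ c)
    (h : ∀ t ∈ spectrum ℝ T, |t| ≤ c) : ‖T‖ ≤ c := by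
  lift c to NNReal using hc
  have hradius : spectralRadius ℝ T ≤ c := iSup₂_le fun t ht => by exact_mod_cast h t ht
  rw [T.spectralRadius_eq_nnnorm hT] at hradius
  exact_mod_cast hradius

theorem le_inner_map_self_of_forall_le_spectrum (hT : IsSelfAdjoint T) {c : ℝ}
    (h : ∀ t ∈ spectrum ℝ T, c ≤ t) (x : H) : c * ‖x‖ ^ 2 ≤ ⟪T x, x⟫ := by
  set k := max ‖T‖ c
  have hbound : ‖algebraMap ℝ (H →L[ℝ] H) k - T‖ ≤ k - c := by
    refine norm_le_of_forall_abs_spectrum_le ((IsSelfAdjoint.algebraMap _ (.all k)).sub hT)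
      (sub_nonneg.2 (le_max_right _ _)) ?_
    rw [← spectrum.singleton_sub_eq, Set.singleton_sub]
    rintro _ ⟨t, ht, rfl⟩
    have htk : t ≤ k :=
      calc t ≤ ‖T‖ * ‖(1 : H →L[ℝ] H)‖ :=
            (le_abs_self t).trans (spectrum.norm_le_norm_mul_of_mem ht)
        _ ≤ ‖T‖ := mul_le_of_le_one_right (norm_nonneg T) ContinuousLinearMap.norm_id_le
        _ ≤ k := le_max_left _ _
    rw [abs_of_nonneg (sub_nonneg.2 htk)]
    linarith [h t ht]
  have hinner : ⟪(algebraMap ℝ (H →L[ℝ] H) k - T) x, x⟫ ≤ (k - c) * ‖x‖ ^ 2 :=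
    calc _ ≤ ‖(algebraMap ℝ (H →L[ℝ] H) k - T) x‖ * ‖x‖ := real_inner_le_norm _ _
      _ ≤ (k - c) * ‖x‖ * ‖x‖ := by gcongr; exact ContinuousLinearMap.le_of_opNorm_le _ hbound x
      _ = (k - c) * ‖x‖ ^ 2 := by ring
  rw [_root_.sub_apply, inner_sub_left, Algebra.algebraMap_eq_smul_one, _root_.smul_apply,
    one_apply_eq_self, real_inner_smul_left, real_inner_self_eq_norm_sq] at hinner
  linarith

theorem exists_isLeast_spectrum [Nontrivial H] (hT : IsSelfAdjoint T) :
    ∃ m, IsLeast (spectrum ℝ T) m := by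
  refine (spectrum.isCompact T).exists_isLeast (Set.nonempty_iff_ne_empty.2 fun hempty => ?_)
  have hzero : T = 0 :=
    norm_le_zero_iff.1 (norm_le_of_forall_abs_spectrum_le hT le_rfl (by simp [hempty]))
  simp [hzero] at hempty

theorem le_norm_map_of_forall_le_abs_spectrum (hT : IsSelfAdjoint T) {r : ℝ} (hr : 0 < r)
    (h : ∀ t ∈ spectrum ℝ T, r ≤ |t|) (x : H) : r * ‖x‖ ≤ ‖T x‖ := by
  have hunit : IsUnit T := spectrum.zero_notMem_iff ℝ |>.1 fun h0 => by
    simpa [hr.not_ge] using h 0 h0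
  obtain ⟨S, rfl⟩ := hunit
  have hinv : ‖(↑S⁻¹ : H →L[ℝ] H)‖ ≤ r⁻¹ := by
    have hself : IsSelfAdjoint (↑S⁻¹ : H →L[ℝ] H) := by
      have hS : star S = S := Units.ext hT
      exact congrArg Units.val ((star_inv S).trans (by rw [hS]))
    refine norm_le_of_forall_abs_spectrum_le hself (inv_nonneg.2 hr.le) fun t ht => ?_
    have ht0 : t ≠ 0 := spectrum.ne_zero_of_mem_of_unit ht
    have hinv_mem := (spectrum.inv_mem_iff (r := Units.mk0 t ht0) (a := S⁻¹)).1 ht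
    rw [inv_inv, Units.val_inv_eq_inv_val, Units.val_mk0] at hinv_mem
    exact (le_inv_comm₀ hr (abs_pos.2 ht0)).1 (abs_inv t ▸ h _ hinv_mem)
  rw [mul_comm, ← le_div_iff₀ hr, div_eq_inv_mul]
  calc ‖x‖ = ‖(↑S⁻¹ : H →L[ℝ] H) ((S : H →L[ℝ] H) x)‖ := by
        rw [← mul_apply_eq_comp, Units.inv_mul, one_apply_eq_self]
    _ ≤ r⁻¹ * ‖(S : H →L[ℝ] H) x‖ := ContinuousLinearMap.le_of_opNorm_le _ hinv _

theorem mul_inner_map_self_le_norm_map_sq (hT : IsSelfAdjoint T) {δ : ℝ} (hδ : 0 < δ)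
    (hgap : ∀ t ∈ spectrum ℝ T, t ≤ 0 ∨ δ ≤ t) (x : H) : δ * ⟪T x, x⟫ ≤ ‖T x‖ ^ 2 := by
  have hshift : δ / 2 * ‖x‖ ≤ ‖(T - algebraMap ℝ (H →L[ℝ] H) (δ / 2)) x‖ := by
    refine le_norm_map_of_forall_le_abs_spectrum
      (hT.sub (IsSelfAdjoint.algebraMap _ (.all _))) (half_pos hδ) ?_ x
    rw [← spectrum.sub_singleton_eq, Set.sub_singleton]
    rintro _ ⟨t, ht, rfl⟩
    rcases hgap t ht with h | h
    · exact le_abs.2 (Or.inr (by linarith))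
    · exact le_abs.2 (Or.inl (by linarith))
  rw [_root_.sub_apply, Algebra.algebraMap_eq_smul_one, _root_.smul_apply, one_apply_eq_self]
    at hshift
  have hsq := pow_le_pow_left₀ (by positivity) hshift 2
  rw [norm_sub_sq_real, real_inner_smul_right, norm_smul, Real.norm_of_nonneg (half_pos hδ).le]
    at hsq
  linarith

theorem mul_norm_sq_le_inner_map_self_of_mem_orthogonal_ker (hT : T.IsPositive) {δ : ℝ}
    (hδ : 0 < δ) (hgap : ∀ t ∈ spectrum ℝ T, t ≤ 0 ∨ δ ≤ t) {y : H} (hy : y ∈ T.kerᗮ) :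
    δ * ‖y‖ ^ 2 ≤ ⟪T y, y⟫ := by
  rw [T.orthogonal_ker, hT.isSelfAdjoint.adjoint_eq] at hy
  refine closure_minimal (s := (T.range : Set H)) (t := {y | δ * ‖y‖ ^ 2 ≤ ⟪T y, y⟫}) ?_
    (isClosed_le (by fun_prop) (by fun_prop)) hy
  rintro _ ⟨x, rfl⟩
  rcases eq_or_ne (T x) 0 with hx | hx
  · simp [hx]
  · refine le_of_mul_le_mul_right ?_ (pow_pos (norm_pos_iff.2 hx) 2)
    calc δ * ‖T x‖ ^ 2 * ‖T x‖ ^ 2 = δ * ‖T x‖ ^ 4 := by ring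
      _ ≤ δ * (⟪T x, x⟫ * ⟪T (T x), T x⟫) := by
        gcongr; exact norm_map_pow_four_le_of_isPositive hT x
      _ = ⟪T (T x), T x⟫ * (δ * ⟪T x, x⟫) := by ring
      _ ≤ ⟪T (T x), T x⟫ * ‖T x‖ ^ 2 :=
        mul_le_mul_of_nonneg_left (mul_inner_map_self_le_norm_map_sq hT.isSelfAdjoint hδ hgap x)
          (hT.inner_nonneg_left _)

theorem exists_norm_map_sub_smul_le (hT : T.IsPositive) {δ : ℝ} (hδ : 0 < δ)
    (hgap : ∀ t ∈ spectrum ℝ T, t ≤ 0 ∨ δ ≤ t) {c l : ℝ}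
    (hc : ∀ x, ⟪T x, x⟫ ≤ c * ‖x‖ ^ 2) (hcl : c < 2 * l) (hl : 0 < l) :
    ∃ ρ, 0 ≤ ρ ∧ ρ < l ∧ ∀ y ∈ T.kerᗮ, ‖T y - l • y‖ ≤ ρ * ‖y‖ := by
  refine ⟨√(l ^ 2 - (2 * l - c) * δ), Real.sqrt_nonneg _, ?_, fun y hy => ?_⟩
  · rw [Real.sqrt_lt' hl]
    linarith [mul_pos (sub_pos.2 hcl) hδ]
  · have hsq : ‖T y - l • y‖ ^ 2 ≤ (l ^ 2 - (2 * l - c) * δ) * ‖y‖ ^ 2 := by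
      rw [norm_sub_sq_real, real_inner_smul_right, norm_smul, mul_pow, Real.norm_eq_abs, sq_abs]
      linarith [norm_map_sq_le_of_isPositive hT hc y, mul_le_mul_of_nonneg_left
        (mul_norm_sq_le_inner_map_self_of_mem_orthogonal_ker hT hδ hgap hy) (sub_pos.2 hcl).le]
    calc ‖T y - l • y‖ = √(‖T y - l • y‖ ^ 2) := (Real.sqrt_sq (norm_nonneg _)).symm
      _ ≤ √((l ^ 2 - (2 * l - c) * δ) * ‖y‖ ^ 2) := Real.sqrt_le_sqrt hsq
      _ = √(l ^ 2 - (2 * l - c) * δ) * ‖y‖ := by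
        rw [Real.sqrt_mul' _ (sq_nonneg _), Real.sqrt_sq (norm_nonneg _)]

theorem norm_pow_of_isSelfAdjoint [Nontrivial H] (hT : IsSelfAdjoint T) (n : ℕ) :
    ‖T ^ n‖ = ‖T‖ ^ n := by
  refine le_antisymm (norm_pow_le T n) ?_
  rcases eq_or_ne T 0 with rfl | hT0
  · rcases n.eq_zero_or_pos with rfl | hn
    · simp
    · simp [zero_pow hn.ne']
  · have hle : n ≤ 2 ^ n := Nat.lt_two_pow_self.le
    refine le_of_mul_le_mul_right ?_ (pow_pos (norm_pos_iff.2 hT0) (2 ^ n - n))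
    calc ‖T‖ ^ n * ‖T‖ ^ (2 ^ n - n) = ‖T ^ 2 ^ n‖ := by
          rw [← pow_add, Nat.add_sub_cancel' hle, hT.norm_pow_two_pow]
      _ = ‖T ^ n * T ^ (2 ^ n - n)‖ := by rw [← pow_add, Nat.add_sub_cancel' hle]
      _ ≤ ‖T ^ n‖ * ‖T‖ ^ (2 ^ n - n) :=
        (norm_mul_le _ _).trans (by gcongr; exact norm_pow_le _ _)

theorem tendsto_one_sub_pow_of_mem_orthogonal_ker (hT : T.IsPositive) {c : ℝ} (hc2 : c < 2)
    (hc : ∀ x, ⟪T x, x⟫ ≤ c * ‖x‖ ^ 2) {y : H} (hy : y ∈ T.kerᗮ) :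
    Tendsto (fun n : ℕ => ((1 - T) ^ n) y) atTop (𝓝 0) := by
  have hlip (n : ℕ) : LipschitzWith 1 ⇑((1 - T) ^ n) := by
    have hstep : LipschitzWith 1 ⇑(1 - T) :=
      AddMonoidHomClass.lipschitz_of_bound_nnnorm _ 1 fun x => by
        rw [one_mul]
        exact norm_one_sub_map_le hT hc2 hc x
    rw [FunLike.coe_pow_eq_iterate]
    simpa using hstep.iterate n
  have hclosed : IsClosed {y : H | Tendsto (fun n : ℕ => ((1 - T) ^ n) y) atTop (𝓝 0)} :=
    (LipschitzWith.uniformEquicontinuous _ 1 hlip).equicontinuous.isClosed_setOfPred_tendsto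
      continuous_const
  rw [T.orthogonal_ker, hT.isSelfAdjoint.adjoint_eq] at hy
  refine closure_minimal (s := (T.range : Set H)) ?_ hclosed hy
  rintro _ ⟨w, rfl⟩
  refine (tendsto_map_one_sub_pow hT hc2 hc w).congr fun n => ?_
  have hcomm : Commute T ((1 - T) ^ n) := ((Commute.one_right T).sub_right (.refl T)).pow_right n
  exact congr($hcomm w)

theorem tendsto_one_sub_pow (hT : T.IsPositive) {c : ℝ} (hc2 : c < 2)
    (hc : ∀ x, ⟪T x, x⟫ ≤ c * ‖x‖ ^ 2) (w : H) :
    Tendsto (fun n : ℕ => ((1 - T) ^ n) w) atTop (𝓝 (T.ker.starProjection w)) := by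
  set k := T.ker.starProjection w
  have hk (n : ℕ) : ((1 - T) ^ n) k = k := by
    have hk0 : T k = 0 := T.ker.starProjection_apply_mem w
    rw [FunLike.coe_pow_eq_iterate]
    exact Function.iterate_fixed (by simp [hk0]) n
  have hperp := tendsto_one_sub_pow_of_mem_orthogonal_ker hT hc2 hc
    (T.ker.sub_starProjection_mem_orthogonal w)
  simpa [map_sub, hk, k] using hperp.add_const k

end Spectral

/-! ### Iterates near a fixed point -/

/-- The points whose whole forward orbit under `F` stays in `V`. Instability and generic instability
are expressed by this set failing to be a neighbourhood, or having empty interior; both are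
topological, hence can be checked after a linear change of coordinates. -/
def trappedSet {α : Type*} (F : α → α) (V : Set α) : Set α :=
  {x | ∀ n : ℕ, F^[n] x ∈ V}

theorem trappedSet_preimage_of_semiconj {α β : Type*} {e : α → β} {F : α → α} {G : β → β}
    (h : Function.Semiconj e F G) (V : Set β) :
    trappedSet F (e ⁻¹' V) = e ⁻¹' trappedSet G V := by
  ext x
  simp only [trappedSet, Set.mem_ofPred_eq, Set.mem_preimage, (h.iterate_right _).eq]

section MetricSpace

variable {α : Type*} [MetricSpace α] [CompleteSpace α] {F : α → α} {z : α} {σ : ℝ}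

theorem exists_isFixedPt_tendsto_iterate {R : ℝ} (hσ0 : 0 ≤ σ) (hσ : σ < 1)
    (hF : ∀ x ∈ Metric.ball z R, dist (F (F x)) (F x) ≤ σ * dist (F x) x)
    (hcont : ∀ x ∈ Metric.ball z R, ContinuousAt F x) {x : α} {r : ℝ} (hr : r < R)
    (hx : dist x z + dist x (F x) / (1 - σ) ≤ r) :
    ∃ y, dist y z ≤ r ∧ F y = y ∧ Tendsto (fun n => F^[n] x) atTop (𝓝 y) := by
  have horbit (n : ℕ) : F^[n] x ∈ Metric.closedBall z r ∧
      dist (F^[n] x) (F^[n + 1] x) ≤ dist x (F x) * σ ^ n := by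
    induction n using Nat.strong_induction_on with
    | _ n ih =>
      have hsum : dist x (F^[n] x) ≤ dist x (F x) / (1 - σ) :=
        calc dist x (F^[n] x) ≤ ∑ k ∈ Finset.range n, dist x (F x) * σ ^ k :=
              dist_le_range_sum_of_dist_le (f := fun n => F^[n] x) n fun hk => (ih _ hk).2
          _ = dist x (F x) * ∑ k ∈ Finset.range n, σ ^ k := (Finset.mul_sum ..).symm
          _ ≤ dist x (F x) * (1 - σ)⁻¹ := by
            gcongr
            rw [← tsum_geometric_of_lt_one hσ0 hσ]
            exact (summable_geometric_of_lt_one hσ0 hσ).sum_le_tsum _ fun _ _ => by positivity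
      have hmem : dist (F^[n] x) z ≤ r := by
        linarith [dist_triangle_left (F^[n] x) z x]
      refine ⟨hmem, ?_⟩
      cases n with
      | zero => simp
      | succ n =>
        obtain ⟨hmem_n, hdist_n⟩ := ih n n.lt_succ_self
        rw [Function.iterate_succ_apply' F (n + 1), Function.iterate_succ_apply' F n, dist_comm]
        rw [Function.iterate_succ_apply' F n, dist_comm] at hdist_n
        calc _ ≤ σ * dist (F (F^[n] x)) (F^[n] x) :=
              hF _ (Metric.closedBall_subset_ball hr hmem_n)
          _ ≤ σ * (dist x (F x) * σ ^ n) := by gcongr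
          _ = dist x (F x) * σ ^ (n + 1) := by ring
  obtain ⟨y, hy⟩ := cauchySeq_tendsto_of_complete
    (cauchySeq_of_le_geometric σ _ hσ fun n => (horbit n).2)
  have hyr : y ∈ Metric.closedBall z r :=
    Metric.isClosed_closedBall.mem_of_tendsto hy (.of_forall fun n => (horbit n).1)
  refine ⟨y, hyr, isFixedPt_of_tendsto_iterate hy ?_, hy⟩
  exact hcont y (Metric.closedBall_subset_ball hr hyr)

theorem eventually_exists_isFixedPt_tendsto_iterate (hσ0 : 0 ≤ σ) (hσ : σ < 1) (hz : F z = z)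
    (hF : ∀ᶠ x in 𝓝 z, dist (F (F x)) (F x) ≤ σ * dist (F x) x)
    (hcont : ∀ᶠ x in 𝓝 z, ContinuousAt F x) {N : Set α} (hN : N ∈ 𝓝 z) :
    ∀ᶠ x in 𝓝 z, ∃ y ∈ N, F y = y ∧ Tendsto (fun n => F^[n] x) atTop (𝓝 y) := by
  obtain ⟨R, hR, hball⟩ := Metric.eventually_nhds_iff_ball.1 (hF.and (hcont.and hN))
  have htend : Tendsto (fun x => dist x z + dist x (F x) / (1 - σ)) (𝓝 z) (𝓝 0) := by
    have hFz : Tendsto F (𝓝 z) (𝓝 z) := by simpa only [hz] using hcont.self_of_nhds.tendsto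
    simpa using (tendsto_id.dist (tendsto_const_nhds (x := z))).add
      ((tendsto_id.dist hFz).div_const (1 - σ))
  filter_upwards [htend.eventually_le_const (half_pos hR)] with x hx
  obtain ⟨y, hyz, hy⟩ := exists_isFixedPt_tendsto_iterate hσ0 hσ (fun x hx => (hball x hx).1)
    (fun x hx => (hball x hx).2.1) (half_lt_self hR) hx
  exact ⟨y, (hball y (Metric.mem_ball.2 (hyz.trans_lt (half_lt_self hR)))).2.2, hy⟩

end MetricSpace

section Banach

variable {E : Type*} [NormedAddCommGroup E] [NormedSpace ℝ E] {F : E → E} {S : E →L[ℝ] E} {z : E}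

theorem eventually_continuousAt_of_hasStrictFDerivAt (hF : HasStrictFDerivAt F S z) :
    ∀ᶠ x in 𝓝 z, ContinuousAt F x := by
  obtain ⟨s, hs, happrox⟩ := hF.approximates_deriv_on_nhds (c := 1) (.inr one_pos)
  filter_upwards [eventually_mem_nhds_iff.2 hs] with x hx
  exact happrox.continuousOn.continuousAt hx

section NormallyContracting

variable {V : Submodule ℝ E} {ρ : ℝ} {s : Set E} {η : NNReal}

theorem mul_norm_sub_le_displacement (hF : ApproximatesLinearOn F S s η)
    (hρ : ∀ y ∈ V, ‖S y‖ ≤ ρ * ‖y‖) {x w : E} (hx : x ∈ s) (hw : w ∈ s) (hfix : F w = w)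
    (hxw : x - w ∈ V) : (1 - ρ - η) * ‖x - w‖ ≤ ‖F x - x‖ := by
  have herr : ‖F x - w - S (x - w)‖ ≤ η * ‖x - w‖ := by simpa only [hfix] using hF x hx w hw
  have hsplit : x - w = (F x - w - S (x - w)) - (F x - x) + S (x - w) := by abel
  have hle : ‖x - w‖ ≤ η * ‖x - w‖ + ‖F x - x‖ + ρ * ‖x - w‖ :=
    calc ‖x - w‖ = ‖(F x - w - S (x - w)) - (F x - x) + S (x - w)‖ := by rw [← hsplit]
      _ ≤ ‖F x - w - S (x - w)‖ + ‖F x - x‖ + ‖S (x - w)‖ :=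
        norm_add_le_of_le (norm_sub_le _ _) le_rfl
      _ ≤ η * ‖x - w‖ + ‖F x - x‖ + ρ * ‖x - w‖ := by gcongr; exact hρ _ hxw
  linarith

theorem displacement_map_le (hF : ApproximatesLinearOn F S s η)
    (hSV : ∀ y ∈ V, S y ∈ V) (hρ0 : 0 ≤ ρ) (hρ : ∀ y ∈ V, ‖S y‖ ≤ ρ * ‖y‖) {x w : E}
    (hx : x ∈ s) (hFx : F x ∈ s) (hw : w ∈ s) (hfix : F w = w) (hxw : x - w ∈ V) :
    ‖F (F x) - F x‖ ≤ (ρ + η) * ‖F x - x‖ + (ρ + ‖S‖) * (η * ‖x - w‖) := by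
  set y := x - w
  set e := F x - w - S y
  have he : ‖e‖ ≤ η * ‖y‖ := by simpa only [hfix] using hF x hx w hw
  have hdisp : F x - x = (S y - y) + e := by simp only [e, y]; abel
  have hlin : ‖S y - y‖ ≤ ‖F x - x‖ + η * ‖y‖ := by
    rw [← sub_eq_iff_eq_add.2 hdisp]
    exact norm_sub_le_of_le le_rfl he
  calc ‖F (F x) - F x‖
      = ‖(F (F x) - F x - S (F x - x)) + S (S y - y) + S e‖ := by
        rw [add_assoc, ← map_add, ← hdisp, sub_add_cancel]
    _ ≤ η * ‖F x - x‖ + ρ * (‖F x - x‖ + η * ‖y‖) + ‖S‖ * (η * ‖y‖) := by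
        refine norm_add_le_of_le (norm_add_le_of_le (hF _ hFx _ hx) ?_)
          (S.le_opNorm_of_le he)
        exact (hρ _ (V.sub_mem (hSV _ hxw) hxw)).trans (by gcongr)
    _ = (ρ + η) * ‖F x - x‖ + (ρ + ‖S‖) * (η * ‖y‖) := by ring

variable {P : Type*} {l : Filter P} {U : P → E}

theorem eventually_displacement_map_le (hF : HasStrictFDerivAt F S z) (hz : F z = z)
    (hSV : ∀ y ∈ V, S y ∈ V) (hρ0 : 0 ≤ ρ) (hρ : ∀ y ∈ V, ‖S y‖ ≤ ρ * ‖y‖)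
    (hU : Tendsto U l (𝓝 z))
    (hproj : ∀ N ∈ l, ∀ᶠ x in 𝓝 z, ∃ p ∈ N, F (U p) = U p ∧ x - U p ∈ V)
    {σ : ℝ} (hρσ : ρ < σ) (hσ1 : σ < 1) :
    ∀ᶠ x in 𝓝 z, ‖F (F x) - F x‖ ≤ σ * ‖F x - x‖ := by
  obtain ⟨η, hη0, hη1, hησ⟩ : ∃ η : ℝ, 0 < η ∧ ρ + η < 1 ∧
      ρ + η + (ρ + ‖S‖) * (η / (1 - ρ - η)) < σ := by
    have hη1 : ∀ᶠ η in 𝓝[>] (0 : ℝ), ρ + η < 1 :=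
      nhdsWithin_le_nhds <| Tendsto.eventually_lt_const (by linarith : ρ + 0 < 1)
        (Continuous.tendsto (by fun_prop) 0)
    have hησ : ∀ᶠ η in 𝓝[>] (0 : ℝ), ρ + η + (ρ + ‖S‖) * (η / (1 - ρ - η)) < σ := by
      refine nhdsWithin_le_nhds <| Tendsto.eventually_lt_const (v := ρ) hρσ ?_
      have hne : 1 - ρ - 0 ≠ 0 := by linarith
      have hcont : ContinuousAt (fun η => ρ + η + (ρ + ‖S‖) * (η / (1 - ρ - η))) 0 := by
        fun_prop (disch := exact hne)
      simpa using hcont.tendsto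
    exact (eventually_mem_nhdsWithin.and (hη1.and hησ)).exists
  lift η to NNReal using hη0.le
  obtain ⟨s, hs, happrox⟩ := hF.approximates_deriv_on_nhds (c := η) (.inr (by exact_mod_cast hη0))
  have hFs : ∀ᶠ x in 𝓝 z, F x ∈ s := by
    have := hF.continuousAt.tendsto
    rw [hz] at this
    exact this hs
  filter_upwards [hs, hFs, hproj _ (hU hs)] with x hx hFx ⟨p, hp, hfix, hxp⟩
  have hdist : ‖x - U p‖ ≤ ‖F x - x‖ / (1 - ρ - η) :=
    (le_div_iff₀' (by linarith)).2 (mul_norm_sub_le_displacement happrox hρ hx hp hfix hxp)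
  calc ‖F (F x) - F x‖ ≤ (ρ + η) * ‖F x - x‖ + (ρ + ‖S‖) * (η * ‖x - U p‖) :=
        displacement_map_le happrox hSV hρ0 hρ hx hFx hp hfix hxp
    _ ≤ (ρ + η) * ‖F x - x‖ + (ρ + ‖S‖) * (η * (‖F x - x‖ / (1 - ρ - η))) := by gcongr
    _ = (ρ + η + (ρ + ‖S‖) * (η / (1 - ρ - η))) * ‖F x - x‖ := by ring
    _ ≤ σ * ‖F x - x‖ := by gcongr

theorem eventually_eq_of_isFixedPt (hF : HasStrictFDerivAt F S z) (hρ1 : ρ < 1)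
    (hρ : ∀ y ∈ V, ‖S y‖ ≤ ρ * ‖y‖) (hU : Tendsto U l (𝓝 z))
    (hproj : ∀ N ∈ l, ∀ᶠ x in 𝓝 z, ∃ p ∈ N, F (U p) = U p ∧ x - U p ∈ V)
    {N : Set P} (hN : N ∈ l) : ∀ᶠ x in 𝓝 z, F x = x → ∃ p ∈ N, x = U p := by
  obtain ⟨η, hη0, hη1⟩ := exists_between (sub_pos.2 hρ1)
  lift η to NNReal using hη0.le
  obtain ⟨s, hs, happrox⟩ := hF.approximates_deriv_on_nhds (c := η) (.inr (by exact_mod_cast hη0))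
  filter_upwards [hs, hproj _ (inter_mem hN (hU hs))] with x hx ⟨p, hp, hfix, hxp⟩ hFx
  have hle := mul_norm_sub_le_displacement happrox hρ hx hp.2 hfix hxp
  rw [hFx, sub_self, norm_zero] at hle
  have hzero : ‖x - U p‖ ≤ 0 := nonpos_of_mul_nonpos_right hle (by linarith)
  exact ⟨p, hp.1, sub_eq_zero.1 (norm_le_zero_iff.1 hzero)⟩

theorem eventually_tendsto_iterate_of_normally_contracting [CompleteSpace E]
    (hF : HasStrictFDerivAt F S z) (hz : F z = z) (hSV : ∀ y ∈ V, S y ∈ V) (hρ0 : 0 ≤ ρ)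
    (hρ1 : ρ < 1) (hρ : ∀ y ∈ V, ‖S y‖ ≤ ρ * ‖y‖) (hU : Tendsto U l (𝓝 z))
    (hproj : ∀ N ∈ l, ∀ᶠ x in 𝓝 z, ∃ p ∈ N, F (U p) = U p ∧ x - U p ∈ V)
    {N : Set P} (hN : N ∈ l) :
    ∀ᶠ x in 𝓝 z, ∃ p ∈ N, Tendsto (fun n => F^[n] x) atTop (𝓝 (U p)) := by
  obtain ⟨σ, hρσ, hσ1⟩ := exists_between hρ1
  have hcontract := eventually_displacement_map_le hF hz hSV hρ0 hρ hU hproj hρσ hσ1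
  simp only [← dist_eq_norm] at hcontract
  filter_upwards [eventually_exists_isFixedPt_tendsto_iterate (hρ0.trans hρσ.le) hσ1 hz hcontract
    (eventually_continuousAt_of_hasStrictFDerivAt hF)
    (eventually_eq_of_isFixedPt hF hρ1 hρ hU hproj hN)] with x ⟨y, hy, hfix, hlim⟩
  obtain ⟨p, hp, rfl⟩ := hy hfix
  exact ⟨p, hp, hlim⟩

end NormallyContracting

section Escaping

variable {C R κ b : ℝ}

theorem norm_pow_apply_le_mul_pow {w : E} (hw : ‖w‖ ≤ b) (n : ℕ) : ‖(S ^ n) w‖ ≤ b * ‖S‖ ^ n := by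
  induction n with
  | zero => simpa using hw
  | succ n ih =>
    rw [pow_succ', mul_apply_eq_comp]
    calc ‖S ((S ^ n) w)‖ ≤ ‖S‖ * (b * ‖S‖ ^ n) := S.le_opNorm_of_le ih
      _ = b * ‖S‖ ^ (n + 1) := by ring

/-- The remainder of step `n` is at most `C * (2 * (b * ‖S‖ ^ n)) ^ 2`, so the errors sum up like a
geometric series of ratio `‖S‖ ^ 2`, dominated by its last term. -/
theorem norm_iterate_sub_pow_apply_le (hC : 0 ≤ C) (hκ0 : 0 ≤ κ) (hS : 1 < ‖S‖)
    (hF : ∀ x ∈ Metric.ball z R, ‖F x - z - S (x - z)‖ ≤ C * ‖x - z‖ ^ 2)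
    (hκ : κ * (‖S‖ ^ 2 - ‖S‖) = 4 * C) {w : E} (hw : ‖w‖ ≤ b) {n : ℕ}
    (hκb : κ * (b * ‖S‖ ^ n) ≤ 1) (hbR : 2 * (b * ‖S‖ ^ n) < R) :
    ‖F^[n] (z + w) - z - (S ^ n) w‖ ≤ κ * (b * ‖S‖ ^ n) ^ 2 := by
  have hb : 0 ≤ b := (norm_nonneg w).trans hw
  induction n with
  | zero => simpa using mul_nonneg hκ0 (sq_nonneg b)
  | succ n ih =>
    have hmono : b * ‖S‖ ^ n ≤ b * ‖S‖ ^ (n + 1) := by gcongr; exacts [hS.le, n.le_succ]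
    have hκn : κ * (b * ‖S‖ ^ n) ≤ 1 := (mul_le_mul_of_nonneg_left hmono hκ0).trans hκb
    specialize ih hκn (by linarith)
    rw [Function.iterate_succ_apply', pow_succ', mul_apply_eq_comp]
    set x := F^[n] (z + w)
    set v := (S ^ n) w
    set q := b * ‖S‖ ^ n
    have hq : 0 ≤ q := by positivity
    have hx : ‖x - z‖ ≤ 2 * q :=
      calc ‖x - z‖ ≤ ‖x - z - v‖ + ‖v‖ := norm_le_norm_sub_add _ _
        _ ≤ κ * q ^ 2 + q := add_le_add ih (norm_pow_apply_le_mul_pow hw n)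
        _ ≤ 2 * q := by linarith [mul_le_mul_of_nonneg_right hκn hq]
    calc ‖F x - z - S v‖ = ‖(F x - z - S (x - z)) + S (x - z - v)‖ := by
          rw [map_sub S (x - z)]; abel_nf
      _ ≤ C * ‖x - z‖ ^ 2 + ‖S‖ * (κ * q ^ 2) :=
        norm_add_le_of_le (hF x (mem_ball_iff_norm.2 (by linarith))) (S.le_opNorm_of_le ih)
      _ ≤ C * (2 * q) ^ 2 + ‖S‖ * (κ * q ^ 2) := by gcongr
      _ = (4 * C + ‖S‖ * κ) * q ^ 2 := by ring
      _ = κ * (b * ‖S‖ ^ (n + 1)) ^ 2 := by rw [← hκ]; ring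

theorem exists_pow_mul_eq_and_norm_pow_apply_ge (hS : 1 < ‖S‖)
    (hpow : ∀ n : ℕ, ‖S ^ n‖ = ‖S‖ ^ n) {a δ : ℝ} (ha : 0 < a) (hδ : 0 < δ) :
    ∃ b n, b < δ ∧ b * ‖S‖ ^ n = a ∧ ∃ w, ‖w‖ ≤ b ∧ a / 2 ≤ ‖(S ^ n) w‖ := by
  obtain ⟨n, hn⟩ := pow_unbounded_of_one_lt (a / δ) hS
  have hSn : 0 < ‖S‖ ^ n := by positivity
  obtain ⟨v, hv1, hv⟩ := (S ^ n).exists_lt_apply_of_lt_opNorm (r := ‖S‖ ^ n / 2)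
    (by rw [hpow]; exact half_lt_self hSn)
  refine ⟨a / ‖S‖ ^ n, n, (div_lt_comm₀ hδ hSn).1 hn, div_mul_cancel₀ _ hSn.ne',
    (a / ‖S‖ ^ n) • v, ?_, ?_⟩
  · rw [norm_smul, Real.norm_of_nonneg (by positivity)]
    exact mul_le_of_le_one_right (by positivity) hv1.le
  · rw [map_smul, norm_smul, Real.norm_of_nonneg (by positivity)]
    calc a / 2 = a / ‖S‖ ^ n * (‖S‖ ^ n / 2) := by field_simp
      _ ≤ a / ‖S‖ ^ n * ‖(S ^ n) v‖ := by gcongr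

theorem exists_trappedSet_notMem_nhds_of_one_lt_norm
    (hF : (fun x => F x - z - S (x - z)) =O[𝓝 z] fun x => ‖x - z‖ ^ 2)
    (hS : 1 < ‖S‖) (hpow : ∀ n : ℕ, ‖S ^ n‖ = ‖S‖ ^ n) :
    ∃ V ∈ 𝓝 z, trappedSet F V ∉ 𝓝 z := by
  obtain ⟨C, hC, hbound⟩ := hF.exists_pos
  obtain ⟨R, hR, hquad⟩ := Metric.eventually_nhds_iff_ball.1 hbound.bound
  simp only [norm_pow, norm_norm] at hquad
  have hgrow : 0 < ‖S‖ ^ 2 - ‖S‖ := by nlinarith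
  set κ := 4 * C / (‖S‖ ^ 2 - ‖S‖)
  have hκ : 0 < κ := by positivity
  obtain ⟨a, ha, haκR⟩ := exists_between (lt_min (half_pos hR) (by positivity : 0 < 1 / (4 * κ)))
  obtain ⟨haR, haκ⟩ := lt_min_iff.1 haκR
  rw [lt_div_iff₀ (by positivity)] at haκ
  refine ⟨Metric.ball z (a / 4), Metric.ball_mem_nhds z (by positivity), fun htrapped => ?_⟩
  obtain ⟨δ, hδ, hball⟩ := Metric.mem_nhds_iff.1 htrapped
  obtain ⟨b, n, hbδ, hbn, w, hwb, hw⟩ := exists_pow_mul_eq_and_norm_pow_apply_ge hS hpow ha hδ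
  have herr := norm_iterate_sub_pow_apply_le hC.le hκ.le hS hquad
    (div_mul_cancel₀ _ hgrow.ne') hwb (n := n) (by rw [hbn]; linarith) (by rw [hbn]; linarith)
  rw [hbn] at herr
  have hstay : ‖F^[n] (z + w) - z‖ < a / 4 :=
    mem_ball_iff_norm.1 (hball (mem_ball_iff_norm.2 (by simpa using hwb.trans_lt hbδ)) n)
  have hlarge := norm_sub_norm_le ((S ^ n) w) (F^[n] (z + w) - z)
  rw [norm_sub_rev ((S ^ n) w)] at hlarge
  have hsmall : κ * a ^ 2 ≤ a / 4 := by linarith [mul_lt_mul_of_pos_right haκ ha]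
  linarith

end Escaping

section Dominated

variable {p : E →L[ℝ] E} {s : Set E} {η : NNReal} {L ρ k : ℝ}

theorem stretches_and_preserves_cone (hF : ApproximatesLinearOn F S s η) (hcomm : Commute p S)
    (hL : ∀ x, L * ‖p x‖ ≤ ‖S (p x)‖) (hρ0 : 0 ≤ ρ) (hρ : ∀ x, ‖S (x - p x)‖ ≤ ρ * ‖x - p x‖)
    (hkL : k + 2 * η * ‖p‖ ≤ L) (hρk : ρ + 2 * η * ‖1 - p‖ ≤ k) {x y : E} (hx : x ∈ s) (hy : y ∈ s)
    (hcone : ‖x - y - p (x - y)‖ ≤ ‖p (x - y)‖) :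
    k * ‖p (x - y)‖ ≤ ‖p (F x - F y)‖ ∧ ‖F x - F y - p (F x - F y)‖ ≤ ‖p (F x - F y)‖ := by
  set d := x - y
  set e := F x - F y - S d
  have hFd : F x - F y = S d + e := (add_sub_cancel _ _).symm
  have hpS : p (S d) = S (p d) := congr($hcomm d)
  have he : ‖e‖ ≤ 2 * η * ‖p d‖ := by
    have hd : ‖d‖ ≤ 2 * ‖p d‖ := by linarith [norm_le_norm_sub_add d (p d)]
    calc ‖e‖ ≤ η * ‖d‖ := hF x hx y hy
      _ ≤ η * (2 * ‖p d‖) := by gcongr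
      _ = 2 * η * ‖p d‖ := by ring
  have hstretch : k * ‖p d‖ ≤ ‖p (F x - F y)‖ := by
    have hpF : p (F x - F y) = S (p d) + p e := by rw [hFd, map_add, hpS]
    have hle := (hL d).trans (norm_le_add_norm_add (S (p d)) (p e))
    rw [← hpF] at hle
    linarith [p.le_opNorm_of_le he, mul_le_mul_of_nonneg_right hkL (norm_nonneg (p d))]
  refine ⟨hstretch, le_trans ?_ hstretch⟩
  calc ‖F x - F y - p (F x - F y)‖ = ‖S (d - p d) + (1 - p) e‖ := by
        rw [hFd, map_add, hpS, map_sub S d (p d), _root_.sub_apply, one_apply_eq_self]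
        congr 1
        abel
    _ ≤ ρ * ‖p d‖ + ‖1 - p‖ * (2 * η * ‖p d‖) :=
      norm_add_le_of_le ((hρ d).trans (by gcongr)) ((1 - p).le_opNorm_of_le he)
    _ = (ρ + 2 * η * ‖1 - p‖) * ‖p d‖ := by ring
    _ ≤ k * ‖p d‖ := by gcongr

theorem eq_zero_of_trappedSet_of_cone (hF : ApproximatesLinearOn F S s η)
    (hs : Bornology.IsBounded s) (hcomm : Commute p S) (hL : ∀ x, L * ‖p x‖ ≤ ‖S (p x)‖)
    (hρ0 : 0 ≤ ρ) (hρ : ∀ x, ‖S (x - p x)‖ ≤ ρ * ‖x - p x‖) (hk : 1 < k)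
    (hkL : k + 2 * η * ‖p‖ ≤ L) (hρk : ρ + 2 * η * ‖1 - p‖ ≤ k) {x y : E}
    (hx : x ∈ trappedSet F s) (hy : y ∈ trappedSet F s)
    (hcone : ‖x - y - p (x - y)‖ ≤ ‖p (x - y)‖) : p (x - y) = 0 := by
  have hgrow (n : ℕ) : k ^ n * ‖p (x - y)‖ ≤ ‖p (F^[n] x - F^[n] y)‖ ∧
      ‖F^[n] x - F^[n] y - p (F^[n] x - F^[n] y)‖ ≤ ‖p (F^[n] x - F^[n] y)‖ := by
    induction n with
    | zero => simpa using hcone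
    | succ n ih =>
      rw [Function.iterate_succ_apply', Function.iterate_succ_apply']
      obtain ⟨hstretch, hcone'⟩ :=
        stretches_and_preserves_cone hF hcomm hL hρ0 hρ hkL hρk (hx n) (hy n) ih.2
      refine ⟨le_trans ?_ hstretch, hcone'⟩
      calc k ^ (n + 1) * ‖p (x - y)‖ = k * (k ^ n * ‖p (x - y)‖) := by ring
        _ ≤ k * ‖p (F^[n] x - F^[n] y)‖ := mul_le_mul_of_nonneg_left ih.1 (by linarith)
  obtain ⟨D, hD⟩ := hs.exists_norm_le
  by_contra hne
  obtain ⟨n, hn⟩ := pow_unbounded_of_one_lt (‖p‖ * (D + D) / ‖p (x - y)‖) hk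
  rw [div_lt_iff₀ (norm_pos_iff.2 hne)] at hn
  exact absurd (hn.trans_le (hgrow n).1)
    (p.le_opNorm_of_le (norm_sub_le_of_le (hD _ (hx n)) (hD _ (hy n)))).not_gt

theorem exists_interior_trappedSet_eq_empty_of_dominated (hF : HasStrictFDerivAt F S z)
    (hp : IsIdempotentElem p) (hp0 : p ≠ 0) (hcomm : Commute p S)
    (hL : ∀ x, L * ‖p x‖ ≤ ‖S (p x)‖) (hL1 : 1 < L)
    (hρ0 : 0 ≤ ρ) (hρ : ∀ x, ‖S (x - p x)‖ ≤ ρ * ‖x - p x‖) (hρL : ρ < L) :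
    ∃ V ∈ 𝓝 z, interior (trappedSet F V) = ∅ := by
  obtain ⟨k, hk, hkL⟩ := exists_between (max_lt hL1 hρL)
  obtain ⟨hk1, hρk⟩ := max_lt_iff.1 hk
  obtain ⟨η, hη0, hηL, hηk⟩ : ∃ η : ℝ, 0 < η ∧ k + 2 * η * ‖p‖ < L ∧ ρ + 2 * η * ‖1 - p‖ < k := by
    have hηL : ∀ᶠ η in 𝓝[>] (0 : ℝ), k + 2 * η * ‖p‖ < L :=
      nhdsWithin_le_nhds <| Tendsto.eventually_lt_const hkL <|
        Continuous.tendsto' (by fun_prop) _ _ (by simp)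
    have hηk : ∀ᶠ η in 𝓝[>] (0 : ℝ), ρ + 2 * η * ‖1 - p‖ < k :=
      nhdsWithin_le_nhds <| Tendsto.eventually_lt_const hρk <|
        Continuous.tendsto' (by fun_prop) _ _ (by simp)
    exact (eventually_mem_nhdsWithin.and (hηL.and hηk)).exists
  lift η to NNReal using hη0.le
  obtain ⟨s, hs, happrox⟩ := hF.approximates_deriv_on_nhds (c := η) (.inr (by exact_mod_cast hη0))
  refine ⟨s ∩ Metric.ball z 1, inter_mem hs (Metric.ball_mem_nhds z one_pos),
    Set.not_nonempty_iff_eq_empty.1 ?_⟩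
  rintro ⟨x, hx⟩
  obtain ⟨v, hv⟩ : ∃ v, p v ≠ 0 := by simpa [DFunLike.ext_iff] using hp0
  have hpp : p (p v) = p v := congr($hp v)
  obtain ⟨t, hyt, ht⟩ : ∃ t : ℝ, x + t • p v ∈ interior (trappedSet F (s ∩ Metric.ball z 1)) ∧
      t ∈ Set.Ioi 0 := by
    have hline : Tendsto (fun t : ℝ => x + t • p v) (𝓝 0) (𝓝 x) :=
      Continuous.tendsto' (by fun_prop) _ _ (by simp)
    have hmem : ∀ᶠ t in 𝓝[>] (0 : ℝ),
        x + t • p v ∈ interior (trappedSet F (s ∩ Metric.ball z 1)) :=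
      nhdsWithin_le_nhds (hline (isOpen_interior.mem_nhds hx))
    exact (hmem.and eventually_mem_nhdsWithin).exists
  have hzero := eq_zero_of_trappedSet_of_cone (happrox.mono_set Set.inter_subset_left)
    (Metric.isBounded_ball.subset Set.inter_subset_right) hcomm hL hρ0 hρ hk1 hηL.le hηk.le
    (interior_subset hyt) (interior_subset hx) (by simp [hpp])
  simp [hpp, hv, ne_of_gt (Set.mem_Ioi.1 ht)] at hzero

end Dominated

end Banach

/-! ### Self-adjoint linear iterations -/

section LinearIteration

open scoped RealInnerProductSpace

variable {H : Type*} [NormedAddCommGroup H] [InnerProductSpace ℝ H]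
  {A : H →L[ℝ] H} {m dt : ℝ}

theorem nontrivial_of_mem_spectrum (hm : m ∈ spectrum ℝ A) : Nontrivial H := by
  rw [← not_subsingleton_iff_nontrivial]
  intro hH
  rw [spectrum.of_subsingleton] at hm
  exact hm

variable [CompleteSpace H]

theorem inner_neg_smul_map_self_le (hA : IsSelfAdjoint A) (hm : ∀ t ∈ spectrum ℝ A, m ≤ t)
    (x : H) : ⟪(-A) x, x⟫ ≤ -m * ‖x‖ ^ 2 := by
  rw [_root_.neg_apply, inner_neg_left, neg_mul, neg_le_neg_iff]
  exact le_inner_map_self_of_forall_le_spectrum hA hm x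

theorem exists_tendsto_one_add_smul_pow (hA : (-A).IsPositive) (hm : ∀ t ∈ spectrum ℝ A, m ≤ t)
    (hm0 : m < 0) (hdt : 0 < dt) (hdt' : dt < -2 / m) (w : H) :
    ∃ k ∈ A.ker, Tendsto (fun n : ℕ => ((1 + dt • A) ^ n) w) atTop (𝓝 k) := by
  have hsa : IsSelfAdjoint A := by simpa using hA.isSelfAdjoint.neg
  have hbound (x : H) : ⟪(dt • -A) x, x⟫ ≤ (dt * -m) * ‖x‖ ^ 2 := by
    rw [_root_.smul_apply, real_inner_smul_left, mul_assoc]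
    gcongr
    exact inner_neg_smul_map_self_le hsa hm x
  have h2 : dt * -m < 2 := by linarith [(lt_div_iff_of_neg hm0).1 hdt']
  refine ⟨(dt • -A).ker.starProjection w, ?_, ?_⟩
  · have hmem := (dt • -A).ker.starProjection_apply_mem w
    generalize (dt • -A).ker.starProjection w = k at hmem ⊢
    simpa [hdt.ne'] using hmem
  · simpa only [smul_neg, sub_neg_eq_add]
      using tendsto_one_sub_pow (hA.smul_of_nonneg hdt.le) h2 hbound w

theorem exists_norm_one_add_smul_le (hA : (-A).IsPositive) (hm : ∀ t ∈ spectrum ℝ A, m ≤ t)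
    (hm0 : m < 0) (hdt : 0 < dt) (hdt' : dt < -2 / m) {Λmax : ℝ} (hΛ : Λmax < 0)
    (hgap : ∀ t ∈ spectrum ℝ A, t ≠ 0 → t ≤ Λmax) :
    ∃ ρ, 0 ≤ ρ ∧ ρ < 1 ∧ ∀ y ∈ A.kerᗮ, ‖(1 + dt • A) y‖ ≤ ρ * ‖y‖ := by
  have hsa : IsSelfAdjoint A := by simpa using hA.isSelfAdjoint.neg
  have hgap' : ∀ t ∈ spectrum ℝ (-A), t ≤ 0 ∨ -Λmax ≤ t := fun t ht => by
    rw [← spectrum.neg_eq, Set.mem_neg] at ht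
    grind
  have hl : -m < 2 * (1 / dt) := by
    rw [mul_one_div, lt_div_iff₀ hdt]
    linarith [(lt_div_iff_of_neg hm0).1 hdt']
  obtain ⟨ρ, hρ0, hρ, hcontr⟩ := exists_norm_map_sub_smul_le hA (neg_pos.2 hΛ) hgap'
    (inner_neg_smul_map_self_le hsa hm) hl (one_div_pos.2 hdt)
  refine ⟨dt * ρ, by positivity, by rwa [lt_div_iff₀' hdt] at hρ, fun y hy => ?_⟩
  have hker : (-A).ker = A.ker := by
    ext x
    simp
  have hstep : (1 + dt • A) y = -(dt • ((-A) y - (1 / dt) • y)) := by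
    simp [smul_sub, smul_smul, hdt.ne']
  calc ‖(1 + dt • A) y‖ = dt * ‖(-A) y - (1 / dt) • y‖ := by
        rw [hstep, norm_neg, norm_smul, Real.norm_of_nonneg hdt.le]
    _ ≤ dt * (ρ * ‖y‖) := by gcongr; exact hcontr y (hker ▸ hy)
    _ = dt * ρ * ‖y‖ := (mul_assoc _ _ _).symm

theorem one_add_smul_apply_mem_orthogonal_ker (hA : IsSelfAdjoint A) {y : H} (hy : y ∈ A.kerᗮ) :
    (1 + dt • A) y ∈ A.kerᗮ := by
  refine A.kerᗮ.add_mem hy (A.kerᗮ.smul_mem dt fun k hk => ?_)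
  have hAk : (A : H →ₗ[ℝ] H) k = 0 := hk
  exact (hA.isSymmetric k y).symm.trans (by rw [hAk, inner_zero_left])

theorem one_lt_norm_one_add_smul (hm : m ∈ spectrum ℝ A) (hm0 : m < 0) (hdt : -2 / m < dt) :
    1 < ‖1 + dt • A‖ := by
  have := nontrivial_of_mem_spectrum hm
  have hmem : 1 + dt * m ∈ spectrum ℝ (1 + dt • A) := by
    have := spectrum.subset_polynomial_aeval A (1 + Polynomial.C dt * Polynomial.X) ⟨m, hm, rfl⟩
    simpa [Algebra.smul_def] using this
  have hlt : 1 + dt * m < -1 := by linarith [(div_lt_iff_of_neg hm0).1 hdt]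
  calc 1 < -(1 + dt * m) := by linarith
    _ ≤ ‖1 + dt * m‖ := neg_le_abs _
    _ ≤ ‖1 + dt • A‖ := spectrum.norm_le_norm_of_mem hmem

theorem ker_ne_bot_of_zero_mem_spectrum {T : H →L[ℝ] H} (hT : T.IsPositive) {δ : ℝ} (hδ : 0 < δ)
    (hgap : ∀ t ∈ spectrum ℝ T, t ≤ 0 ∨ δ ≤ t) (h0 : 0 ∈ spectrum ℝ T) : T.ker ≠ ⊥ := by
  intro hbot
  refine (spectrum.zero_mem_iff ℝ).1 h0 (ContinuousLinearMap.isUnit_of_forall_le_norm_inner_map T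
    (c := ⟨δ, hδ.le⟩) hδ fun x => ?_)
  have hx : x ∈ T.kerᗮ := by
    rw [hbot, Submodule.bot_orthogonal_eq_top]
    trivial
  calc ‖x‖ ^ 2 * δ = δ * ‖x‖ ^ 2 := mul_comm _ _
    _ ≤ ⟪T x, x⟫ := mul_norm_sq_le_inner_map_self_of_mem_orthogonal_ker hT hδ hgap hx
    _ ≤ ‖⟪T x, x⟫‖ := le_abs_self _

theorem exists_isIdempotentElem_of_zero_mem_spectrum {T : H →L[ℝ] H} (hT : T.IsPositive) {δ : ℝ}
    (hδ : 0 < δ) (hgap : ∀ t ∈ spectrum ℝ T, t ≤ 0 ∨ δ ≤ t) (h0 : 0 ∈ spectrum ℝ T) {c l : ℝ}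
    (hc : ∀ x, ⟪T x, x⟫ ≤ c * ‖x‖ ^ 2) (hcl : c < 2 * l) (hl : 0 < l) :
    ∃ (p : H →L[ℝ] H) (ρ : ℝ), IsIdempotentElem p ∧ p ≠ 0 ∧ T * p = 0 ∧ p * T = 0 ∧ 0 ≤ ρ ∧ ρ < l ∧
      ∀ x, ‖T (x - p x) - l • (x - p x)‖ ≤ ρ * ‖x - p x‖ := by
  obtain ⟨ρ, hρ0, hρ, hcontr⟩ := exists_norm_map_sub_smul_le hT hδ hgap hc hcl hl
  have hTp : T * T.ker.starProjection = 0 :=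
    ContinuousLinearMap.ext fun x => T.ker.starProjection_apply_mem x
  refine ⟨T.ker.starProjection, ρ, T.ker.isIdempotentElem_starProjection, fun hp => ?_, hTp, ?_,
    hρ0, hρ, fun x => hcontr _ (T.ker.sub_starProjection_mem_orthogonal x)⟩
  · refine ker_ne_bot_of_zero_mem_spectrum hT hδ hgap h0 ((Submodule.eq_bot_iff _).2 fun x hx => ?_)
    rw [← Submodule.starProjection_eq_self_iff.2 hx, hp, _root_.zero_apply]
  · simpa [hT.isSelfAdjoint.star_eq, (isSelfAdjoint_starProjection T.ker).star_eq]
      using congrArg star hTp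

theorem exists_interior_trappedSet_eq_empty_of_isPositive {T : H →L[ℝ] H} (hT : T.IsPositive)
    {δ : ℝ} (hδ : 0 < δ) (hgap : ∀ t ∈ spectrum ℝ T, t ≤ 0 ∨ δ ≤ t) (h0 : 0 ∈ spectrum ℝ T)
    {c l : ℝ} (hc : ∀ x, ⟪T x, x⟫ ≤ c * ‖x‖ ^ 2) (hcl : c < 2 * l) (hdt : 0 < dt)
    (hdtl : 1 < dt * l) {F : H → H} {z : H}
    (hF : HasStrictFDerivAt F (dt • (T - algebraMap ℝ (H →L[ℝ] H) l)) z) :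
    ∃ V ∈ 𝓝 z, interior (trappedSet F V) = ∅ := by
  have hl : 0 < l := pos_of_mul_pos_right (one_pos.trans hdtl) hdt.le
  obtain ⟨p, ρ, hp, hp0, hTp, hpT, hρ0, hρ, hcontr⟩ :=
    exists_isIdempotentElem_of_zero_mem_spectrum hT hδ hgap h0 hc hcl hl
  have hcomm : Commute p (dt • (T - algebraMap ℝ (H →L[ℝ] H) l)) :=
    ((show Commute p T from hpT.trans hTp.symm).sub_right (Algebra.commutes l p).symm).smul_right dt
  have hnorm (x : H) : ‖(dt • (T - algebraMap ℝ (H →L[ℝ] H) l)) x‖ = dt * ‖T x - l • x‖ := by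
    rw [_root_.smul_apply, norm_smul, Real.norm_of_nonneg hdt.le, _root_.sub_apply,
      Algebra.algebraMap_eq_smul_one, _root_.smul_apply, one_apply_eq_self]
  refine exists_interior_trappedSet_eq_empty_of_dominated hF hp hp0 (L := dt * l) (ρ := dt * ρ)
    hcomm (fun x => ?_) hdtl (by positivity) (fun x => ?_) (by gcongr)
  · have hTpx : T (p x) = 0 := congr($hTp x)
    rw [hnorm, hTpx, zero_sub, norm_neg, norm_smul, Real.norm_of_nonneg hl.le, mul_assoc]
  · rw [hnorm, mul_assoc]
    gcongr
    exact hcontr x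

theorem isPositive_sub_algebraMap (hA : IsSelfAdjoint A) (hm : ∀ t ∈ spectrum ℝ A, m ≤ t) :
    (A - algebraMap ℝ (H →L[ℝ] H) m).IsPositive := by
  refine (ContinuousLinearMap.isPositive_iff _).2
    ⟨(hA.sub (.algebraMap _ (.all m))).isSymmetric, fun x => ?_⟩
  simpa [inner_sub_left, Algebra.algebraMap_eq_smul_one, real_inner_smul_left]
    using le_inner_map_self_of_forall_le_spectrum hA hm x

theorem exists_interior_trappedSet_eq_empty_of_isolated (hA : (-A).IsPositive)
    (hm : IsLeast (spectrum ℝ A) m) (hm0 : m < 0) (hdt : -2 / m < dt) {Λ' : ℝ} (hΛ' : m < Λ')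
    (hgap : ∀ t ∈ spectrum ℝ A, t ≠ m → Λ' ≤ t) {F : H → H} {z : H}
    (hF : HasStrictFDerivAt F (1 + dt • A) z) :
    ∃ V ∈ 𝓝 z, interior (trappedSet F V) = ∅ := by
  have hsa : IsSelfAdjoint A := by simpa using hA.isSelfAdjoint.neg
  have hdt0 : 0 < dt := (div_pos_of_neg_of_neg (by norm_num) hm0).trans hdt
  set T := A - algebraMap ℝ (H →L[ℝ] H) m with hTdef
  have hT : T.IsPositive := isPositive_sub_algebraMap hsa hm.2
  set l := -m - 1 / dt with hl
  have hdtl : dt * l = -(1 + dt * m) := by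
    rw [hl]
    field_simp
    ring
  have hdtm : 1 < dt * l := by linarith [(div_lt_iff_of_neg hm0).1 hdt]
  have hS : 1 + dt • A = dt • (T - algebraMap ℝ (H →L[ℝ] H) l) := by
    rw [hTdef, sub_sub, ← map_add, smul_sub, Algebra.algebraMap_eq_smul_one, smul_smul,
      mul_add, hdtl, sub_eq_add_neg (dt • A), ← neg_smul, add_comm 1]
    ring_nf
    rw [one_smul]
  have hgapT : ∀ t ∈ spectrum ℝ T, t ≤ 0 ∨ Λ' - m ≤ t := by
    rw [hTdef, ← spectrum.sub_singleton_eq, Set.sub_singleton]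
    rintro _ ⟨t, ht, rfl⟩
    grind
  have h0 : 0 ∈ spectrum ℝ T := by
    rw [hTdef, ← spectrum.sub_singleton_eq, Set.sub_singleton]
    exact ⟨m, hm.1, sub_self m⟩
  have hc (x : H) : ⟪T x, x⟫ ≤ -m * ‖x‖ ^ 2 := by
    simpa [hTdef, inner_sub_left, Algebra.algebraMap_eq_smul_one, real_inner_smul_left]
      using hA.inner_nonneg_left x
  refine exists_interior_trappedSet_eq_empty_of_isPositive hT (sub_pos.2 hΛ') hgapT h0 hc ?_ hdt0
    hdtm (hS ▸ hF)
  exact lt_of_mul_lt_mul_left (by linarith) hdt0.le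

end LinearIteration

/-! ### The linearization at a nondegenerate wave -/

theorem map_pi_eq_sum_smul_single {ι R N F : Type*} [Fintype ι] [DecidableEq ι] [Semiring R]
    [AddCommMonoid N] [Module R N] [FunLike F (ι → R) N] [LinearMapClass F R (ι → R) N]
    (f : F) (a : ι → R) : f a = ∑ j, a j • f (Pi.single j 1) := by
  conv_lhs => rw [pi_eq_sum_univ' a]
  simp only [map_sum, map_smul]

namespace AccelerationOperator

variable {X : Type*} [NormedAddCommGroup X] [NormedSpace ℝ X]
  (M : AccelerationOperator X) {f : StrongDual ℝ X}

theorem op_inv (f : StrongDual ℝ X) : M.op (M.inv f) = f := M.op.apply_symm_apply f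

theorem apply_inv_comm (f g : StrongDual ℝ X) : f (M.inv g) = g (M.inv f) := by
  simpa only [op_inv] using M.hermitian (M.inv f) (M.inv g)

theorem apply_inv_self_pos (hf : f ≠ 0) : 0 < f (M.inv f) := by
  have hinv : M.inv f ≠ 0 := fun h0 => hf (by rw [← M.op_inv f, h0, map_zero])
  simpa only [op_inv] using M.posDef _ hinv

theorem apply_inv_self_nonneg (f : StrongDual ℝ X) : 0 ≤ f (M.inv f) := by
  rcases eq_or_ne f 0 with rfl | hf
  · simp
  · exact (M.apply_inv_self_pos hf).le

theorem eq_zero_of_apply_inv_self (h : f (M.inv f) = 0) : f = 0 :=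
  not_not.1 fun hf => (M.apply_inv_self_pos hf).ne' h

end AccelerationOperator

namespace ConstrainedEquation

variable {X : Type*} [NormedAddCommGroup X] [NormedSpace ℝ X] {r : ℕ}
  (E : ConstrainedEquation X r) (M : AccelerationOperator X) {u : X}

theorem B_apply_inv_sum (u : X) (i : Fin r) (a : Fin r → ℝ) :
    E.B i u (M.inv (∑ j, a j • E.B j u)) = (E.gram M u *ᵥ a) i := by
  simp [gram, Matrix.mulVec, dotProduct, map_sum, mul_comm]

theorem gram_det_ne_zero (hB : LinearIndependent ℝ fun j => E.B j u) :
    (E.gram M u).det ≠ 0 := by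
  intro hdet
  obtain ⟨a, ha, hker⟩ := Matrix.exists_mulVec_eq_zero_iff.2 hdet
  have hself : (∑ i, a i • E.B i u) (M.inv (∑ j, a j • E.B j u)) = 0 := by
    simp only [_root_.sum_apply, _root_.smul_apply, B_apply_inv_sum, hker, Pi.zero_apply,
      smul_zero, Finset.sum_const_zero]
  exact ha (funext (Fintype.linearIndependent_iff.1 hB a (M.eq_zero_of_apply_inv_self hself)))

theorem coeff_sub_sum (hG : (E.gram M u).det ≠ 0) (f : StrongDual ℝ X) (a : Fin r → ℝ) :
    E.coeff M u (f - ∑ j, a j • E.B j u) = E.coeff M u f - a := by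
  have hpair : (fun i => E.B i u (M.inv (f - ∑ j, a j • E.B j u))) =
      (fun i => E.B i u (M.inv f)) - E.gram M u *ᵥ a := by
    ext i
    rw [map_sub, map_sub, B_apply_inv_sum, Pi.sub_apply]
  rw [coeff, hpair, Matrix.mulVec_sub, Matrix.mulVec_mulVec,
    Matrix.nonsing_inv_mul _ (isUnit_iff_ne_zero.2 hG), Matrix.one_mulVec, coeff]

theorem B_apply_inv_sub_projB (hG : (E.gram M u).det ≠ 0) (f : StrongDual ℝ X) (i : Fin r) :
    E.B i u (M.inv (f - E.projB M u f)) = 0 := by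
  rw [projB_apply, map_sub, map_sub, B_apply_inv_sum, coeff, Matrix.mulVec_mulVec,
    Matrix.mul_nonsing_inv _ (isUnit_iff_ne_zero.2 hG), Matrix.one_mulVec, sub_self]

theorem sub_projB_apply_inv_sub_projB (hG : (E.gram M u).det ≠ 0) (f g : StrongDual ℝ X) :
    (f - E.projB M u f) (M.inv (g - E.projB M u g)) = f (M.inv (g - E.projB M u g)) := by
  simp only [_root_.sub_apply f, E.projB_apply M u f, _root_.sum_apply, _root_.smul_apply,
    E.B_apply_inv_sub_projB M hG, smul_zero, Finset.sum_const_zero, sub_zero]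

theorem L0_mu (hG : (E.gram M u).det ≠ 0) (μ : Fin r → ℝ) :
    E.L0 (E.mu M u) u = E.L0 μ u - E.projB M u (E.L0 μ u) := by
  rw [projB_apply, L0, L0, coeff_sub_sum E M hG, mu]
  ext ψ
  simp only [_root_.sub_apply, _root_.sum_apply, _root_.smul_apply, Pi.sub_apply, smul_eq_mul,
    sub_mul, Finset.sum_sub_distrib]
  abel

theorem mu_eq_of_L0_eq_zero (hG : (E.gram M u).det ≠ 0) {μ : Fin r → ℝ} (h0 : E.L0 μ u = 0) :
    E.mu M u = μ := by
  have hcoeff : E.coeff M u (E.L0 μ u) = 0 := by simp [h0, coeff, ← Pi.zero_def]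
  rwa [L0, coeff_sub_sum E M hG, sub_eq_zero] at hcoeff

theorem step_eq_self (hG : (E.gram M u).det ≠ 0) {μ : Fin r → ℝ} (h0 : E.L0 μ u = 0)
    (hC : ∀ j, E.Q j u = E.C j) (h dt : ℝ) : E.step M h dt u = u := by
  simp [step, mu_eq_of_L0_eq_zero E M hG h0, h0, hC]

theorem op_LQC_apply (hG : (E.gram M u).det ≠ 0) (h : ℝ) (μ : Fin r → ℝ) (ψ φ : X) :
    M.op (E.LQC M h μ u ψ) φ =
      -((E.L1 μ u φ - E.projB M u (E.L1 μ u φ))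
        (M.inv (E.L1 μ u ψ - E.projB M u (E.L1 μ u ψ)))) -
      h * ∑ j, E.dQ j u ψ * E.dQ j u φ := by
  rw [LQC_apply, M.op_inv, ← projB_apply, E.sub_projB_apply_inv_sub_projB M hG]
  simp [L1adj]

theorem op_LQC_symm (hG : (E.gram M u).det ≠ 0) (h : ℝ) (μ : Fin r → ℝ) (ψ φ : X) :
    M.op (E.LQC M h μ u ψ) φ = M.op ψ (E.LQC M h μ u φ) := by
  rw [M.hermitian ψ, op_LQC_apply E M hG, op_LQC_apply E M hG, M.apply_inv_comm]
  simp only [mul_comm]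

theorem op_LQC_self_nonpos (hG : (E.gram M u).det ≠ 0) {h : ℝ} (hh : 0 ≤ h) (μ : Fin r → ℝ)
    (ψ : X) : M.op (E.LQC M h μ u ψ) ψ ≤ 0 := by
  have hres := M.apply_inv_self_nonneg (E.L1 μ u ψ - E.projB M u (E.L1 μ u ψ))
  have hdQ : 0 ≤ h * ∑ j, E.dQ j u ψ * E.dQ j u ψ :=
    mul_nonneg hh (Finset.sum_nonneg fun j _ => mul_self_nonneg _)
  rw [op_LQC_apply E M hG]
  linarith

theorem eq_projB_of_op_LQC_self_eq_zero (hG : (E.gram M u).det ≠ 0) {h : ℝ} (hh : 0 < h)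
    {μ : Fin r → ℝ} {ψ : X} (h0 : M.op (E.LQC M h μ u ψ) ψ = 0) :
    E.L1 μ u ψ = E.projB M u (E.L1 μ u ψ) ∧ ∀ j, E.dQ j u ψ = 0 := by
  rw [op_LQC_apply E M hG] at h0
  have hres := M.apply_inv_self_nonneg (E.L1 μ u ψ - E.projB M u (E.L1 μ u ψ))
  have hsq : ∀ j ∈ Finset.univ, 0 ≤ E.dQ j u ψ * E.dQ j u ψ := fun j _ => mul_self_nonneg _
  have hdQ := mul_nonneg hh.le (Finset.sum_nonneg hsq)
  have hdQ0 : ∑ j, E.dQ j u ψ * E.dQ j u ψ = 0 :=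
    (mul_eq_zero.1 (by linarith)).resolve_left hh.ne'
  exact ⟨sub_eq_zero.1 (M.eq_zero_of_apply_inv_self (by linarith)), fun j =>
    mul_self_eq_zero.1 ((Finset.sum_eq_zero_iff_of_nonneg hsq).1 hdQ0 j (Finset.mem_univ j))⟩

section Family

variable {E} {s : ℕ} {U : (Fin r → ℝ) × (Fin s → ℝ) → X} {μ₀ : Fin r → ℝ} {c₀ : Fin s → ℝ}

theorem hasFDerivAt_L0 (hL : DifferentiableAt ℝ E.L00 u) (hB : ∀ j, DifferentiableAt ℝ (E.B j) u)
    (μ : Fin r → ℝ) :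
    HasFDerivAt (E.L0 μ) (fderiv ℝ E.L00 u - ∑ j, μ j • fderiv ℝ (E.B j) u) u :=
  hL.hasFDerivAt.sub (HasFDerivAt.fun_sum fun j _ => (hB j).hasFDerivAt.const_smul (μ j))

theorem L1_eq (hL : DifferentiableAt ℝ E.L00 u) (hB : ∀ j, DifferentiableAt ℝ (E.B j) u)
    (μ : Fin r → ℝ) : E.L1 μ u = fderiv ℝ E.L00 u - ∑ j, μ j • fderiv ℝ (E.B j) u :=
  (hasFDerivAt_L0 hL hB μ).fderiv

theorem hasFDerivAt_uncurry_L0 (hL : DifferentiableAt ℝ E.L00 u)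
    (hB : ∀ j, DifferentiableAt ℝ (E.B j) u) (μ : Fin r → ℝ) :
    HasFDerivAt (fun q : (Fin r → ℝ) × X => E.L0 q.1 q.2)
      ((E.L1 μ u).comp (ContinuousLinearMap.snd ℝ _ _) -
        ∑ j, ((ContinuousLinearMap.proj j).comp (ContinuousLinearMap.fst ℝ _ _)).smulRight
          (E.B j u)) (μ, u) := by
  have hsnd : HasFDerivAt Prod.snd (ContinuousLinearMap.snd ℝ (Fin r → ℝ) X) (μ, u) :=
    hasFDerivAt_snd
  have hproj (j : Fin r) : HasFDerivAt (fun q : (Fin r → ℝ) × X => q.1 j)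
      ((ContinuousLinearMap.proj j).comp (ContinuousLinearMap.fst ℝ _ _)) (μ, u) :=
    ((ContinuousLinearMap.proj (φ := fun _ : Fin r => ℝ) j).comp
      (ContinuousLinearMap.fst ℝ (Fin r → ℝ) X)).hasFDerivAt
  refine ((hL.hasFDerivAt.comp (μ, u) hsnd).sub (HasFDerivAt.fun_sum fun j _ =>
    (hproj j).smul ((hB j).hasFDerivAt.comp (μ, u) hsnd))).congr_fderiv ?_
  rw [L1_eq hL hB]
  refine ContinuousLinearMap.ext fun q => ?_
  simp only [_root_.sub_apply, _root_.sum_apply, _root_.add_apply, _root_.smul_apply,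
    ContinuousLinearMap.comp_apply, ContinuousLinearMap.smulRight_apply, Finset.sum_add_distrib,
    Function.comp_apply]
  abel

theorem L1_fderiv_family (hU : E.IsSolutionFamily U μ₀ c₀)
    (hL : DifferentiableAt ℝ E.L00 (U (μ₀, c₀)))
    (hB : ∀ j, DifferentiableAt ℝ (E.B j) (U (μ₀, c₀))) (a : Fin r → ℝ) (b : Fin s → ℝ) :
    E.L1 μ₀ (U (μ₀, c₀)) (fderiv ℝ U (μ₀, c₀) (a, b)) = ∑ j, a j • E.B j (U (μ₀, c₀)) := by
  have hUd : HasFDerivAt U (fderiv ℝ U (μ₀, c₀)) (μ₀, c₀) :=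
    (hU.1.differentiableAt one_ne_zero).hasFDerivAt
  have hcomp := (hasFDerivAt_uncurry_L0 hL hB μ₀).comp (μ₀, c₀)
    (hasFDerivAt_fst.prodMk hUd)
  have hzero := hcomp.unique ((hasFDerivAt_const 0 _).congr_of_eventuallyEq hU.2)
  have happly := congr($hzero (a, b))
  simpa [sub_eq_zero] using happly

theorem dQdmu_mulVec (hU : DifferentiableAt ℝ U (μ₀, c₀))
    (hQ : ∀ j, DifferentiableAt ℝ (E.Q j) (U (μ₀, c₀))) (a : Fin r → ℝ) (i : Fin r) :
    (E.dQdmu U μ₀ c₀ *ᵥ a) i = E.dQ i (U (μ₀, c₀)) (fderiv ℝ U (μ₀, c₀) (a, 0)) := by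
  have hchain : fderiv ℝ (fun p => E.Q i (U p)) (μ₀, c₀) =
      (E.dQ i (U (μ₀, c₀))).comp (fderiv ℝ U (μ₀, c₀)) := fderiv_comp (μ₀, c₀) (hQ i) hU
  have hsum := map_pi_eq_sum_smul_single ((E.dQ i (U (μ₀, c₀))).comp
    ((fderiv ℝ U (μ₀, c₀)).comp (.inl ℝ (Fin r → ℝ) (Fin s → ℝ)))) a
  simp only [Matrix.mulVec, dotProduct, dQdmu, Matrix.of_apply, hchain]
  exact (hsum.trans (Finset.sum_congr rfl fun j _ => mul_comm _ _)).symm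

end Family

/-- The standing assumptions on the solitary wave `U(μ₀; c₀)`: it belongs to a `C¹` solution family,
satisfies the constraints, the data are `C²` near it, each `δQⱼ/δu` annihilates `ker L₁`, and
`∂Qᵢ/∂μⱼ` is nonsingular. -/
structure IsNondegenerateWave {s : ℕ} (U : (Fin r → ℝ) × (Fin s → ℝ) → X) (μ₀ : Fin r → ℝ)
    (c₀ : Fin s → ℝ) : Prop where
  isSolutionFamily : E.IsSolutionFamily U μ₀ c₀
  Q_eq : ∀ j, E.Q j (U (μ₀, c₀)) = E.C j
  contDiffAt_L00 : ContDiffAt ℝ 2 E.L00 (U (μ₀, c₀))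
  contDiffAt_B : ∀ j, ContDiffAt ℝ 2 (E.B j) (U (μ₀, c₀))
  contDiffAt_Q : ∀ j, ContDiffAt ℝ 2 (E.Q j) (U (μ₀, c₀))
  dQ_eq_zero : ∀ j, ∀ ψ ∈ (E.L1 μ₀ (U (μ₀, c₀))).ker, E.dQ j (U (μ₀, c₀)) ψ = 0
  det_ne_zero : (E.dQdmu U μ₀ c₀).det ≠ 0

namespace IsNondegenerateWave

variable {E} {s : ℕ} {U : (Fin r → ℝ) × (Fin s → ℝ) → X} {μ₀ : Fin r → ℝ} {c₀ : Fin s → ℝ}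

theorem differentiableAt_family (hW : E.IsNondegenerateWave U μ₀ c₀) :
    DifferentiableAt ℝ U (μ₀, c₀) :=
  hW.isSolutionFamily.1.differentiableAt one_ne_zero

theorem differentiableAt_L00 (hW : E.IsNondegenerateWave U μ₀ c₀) :
    DifferentiableAt ℝ E.L00 (U (μ₀, c₀)) :=
  hW.contDiffAt_L00.differentiableAt two_ne_zero

theorem differentiableAt_B (hW : E.IsNondegenerateWave U μ₀ c₀) (j : Fin r) :
    DifferentiableAt ℝ (E.B j) (U (μ₀, c₀)) :=
  (hW.contDiffAt_B j).differentiableAt two_ne_zero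

theorem differentiableAt_Q (hW : E.IsNondegenerateWave U μ₀ c₀) (j : Fin r) :
    DifferentiableAt ℝ (E.Q j) (U (μ₀, c₀)) :=
  (hW.contDiffAt_Q j).differentiableAt two_ne_zero

theorem L0_eq_zero (hW : E.IsNondegenerateWave U μ₀ c₀) : E.L0 μ₀ (U (μ₀, c₀)) = 0 :=
  hW.isSolutionFamily.2.self_of_nhds

theorem L1_fderiv_family (hW : E.IsNondegenerateWave U μ₀ c₀) (a : Fin r → ℝ) (b : Fin s → ℝ) :
    E.L1 μ₀ (U (μ₀, c₀)) (fderiv ℝ U (μ₀, c₀) (a, b)) = ∑ j, a j • E.B j (U (μ₀, c₀)) :=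
  ConstrainedEquation.L1_fderiv_family hW.isSolutionFamily hW.differentiableAt_L00
    hW.differentiableAt_B a b

theorem dQdmu_mulVec (hW : E.IsNondegenerateWave U μ₀ c₀) (a : Fin r → ℝ) (i : Fin r) :
    (E.dQdmu U μ₀ c₀ *ᵥ a) i = E.dQ i (U (μ₀, c₀)) (fderiv ℝ U (μ₀, c₀) (a, 0)) :=
  ConstrainedEquation.dQdmu_mulVec hW.differentiableAt_family hW.differentiableAt_Q a i

theorem eq_zero_of_dQ_fderiv_family (hW : E.IsNondegenerateWave U μ₀ c₀) {a : Fin r → ℝ}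
    (ha : ∀ i, E.dQ i (U (μ₀, c₀)) (fderiv ℝ U (μ₀, c₀) (a, 0)) = 0) : a = 0 :=
  Matrix.eq_zero_of_mulVec_eq_zero hW.det_ne_zero
    (funext fun i => (hW.dQdmu_mulVec a i).trans (ha i))

theorem linearIndependent_B (hW : E.IsNondegenerateWave U μ₀ c₀) :
    LinearIndependent ℝ fun j => E.B j (U (μ₀, c₀)) :=
  Fintype.linearIndependent_iff.2 fun a ha => congrFun <| hW.eq_zero_of_dQ_fderiv_family fun i =>
    hW.dQ_eq_zero i _ ((hW.L1_fderiv_family a 0).trans ha)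

theorem gram_det_ne_zero (hW : E.IsNondegenerateWave U μ₀ c₀) :
    (E.gram M (U (μ₀, c₀))).det ≠ 0 :=
  E.gram_det_ne_zero M hW.linearIndependent_B

theorem mem_ker_L1_of_L1_eq_sum (hW : E.IsNondegenerateWave U μ₀ c₀) {ψ : X} {a : Fin r → ℝ}
    (hL1 : E.L1 μ₀ (U (μ₀, c₀)) ψ = ∑ j, a j • E.B j (U (μ₀, c₀)))
    (hdQ : ∀ j, E.dQ j (U (μ₀, c₀)) ψ = 0) : ψ ∈ (E.L1 μ₀ (U (μ₀, c₀))).ker := by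
  have hdiff : ψ - fderiv ℝ U (μ₀, c₀) (a, 0) ∈ (E.L1 μ₀ (U (μ₀, c₀))).ker := by
    rw [LinearMap.mem_ker, map_sub]
    exact sub_eq_zero.2 (hL1.trans (hW.L1_fderiv_family a 0).symm)
  have ha : a = 0 := hW.eq_zero_of_dQ_fderiv_family fun i => by
    simpa only [map_sub, hdQ, zero_sub, neg_eq_zero] using hW.dQ_eq_zero i _ hdiff
  exact hL1.trans (by simp [ha])

theorem ker_LQC (hW : E.IsNondegenerateWave U μ₀ c₀) {h : ℝ} (hh : 0 < h) :
    (E.LQC M h μ₀ (U (μ₀, c₀))).ker = (E.L1 μ₀ (U (μ₀, c₀))).ker := by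
  refine le_antisymm (fun ψ (hψ : E.LQC M h μ₀ (U (μ₀, c₀)) ψ = 0) => ?_)
    (fun ψ (hψ : E.L1 μ₀ (U (μ₀, c₀)) ψ = 0) => ?_)
  · obtain ⟨hL1, hdQ⟩ := E.eq_projB_of_op_LQC_self_eq_zero M (hW.gram_det_ne_zero M) hh
      (μ := μ₀) (ψ := ψ) (by simp [hψ])
    exact hW.mem_ker_L1_of_L1_eq_sum (hL1.trans (E.projB_apply M _ _)) hdQ
  · have hdQ (j : Fin r) := hW.dQ_eq_zero j ψ hψ
    rw [LinearMap.mem_ker]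
    exact (E.LQC_apply M h μ₀ _ ψ).trans (by simp [← projB_apply, hψ, hdQ])

theorem exists_op_LQC_neg (hW : E.IsNondegenerateWave U μ₀ c₀) (hr : 1 ≤ r) {h : ℝ} (hh : 0 < h) :
    ∃ ψ, M.op (E.LQC M h μ₀ (U (μ₀, c₀)) ψ) ψ < 0 := by
  by_contra! hcon
  have hG := hW.gram_det_ne_zero M
  have hsingle : (Pi.single ⟨0, hr⟩ 1 : Fin r → ℝ) = 0 := hW.eq_zero_of_dQ_fderiv_family <|
    (E.eq_projB_of_op_LQC_self_eq_zero M hG hh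
      (le_antisymm (E.op_LQC_self_nonpos M hG hh.le μ₀ _) (hcon _))).2
  exact one_ne_zero ((Pi.single_eq_zero_iff).1 hsingle)

end IsNondegenerateWave

end ConstrainedEquation

/-! ### Smoothness of the iteration -/

section Calculus

variable {E G W : Type*} [NormedAddCommGroup E] [NormedSpace ℝ E] [NormedAddCommGroup G]
  [NormedSpace ℝ G] [NormedAddCommGroup W] [NormedSpace ℝ W]

theorem isBigO_sub_fderiv_of_contDiffAt {g : E → G} {z : E} (hg : ContDiffAt ℝ 2 g z) :
    (fun x => g x - g z - fderiv ℝ g z (x - z)) =O[𝓝 z] fun x => ‖x - z‖ ^ 2 := by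
  have hfderiv : ContDiffAt ℝ 1 (fderiv ℝ g) z := hg.fderiv_right (by norm_num)
  obtain ⟨C, hC, hbound⟩ :=
    (hfderiv.differentiableAt one_ne_zero).isBigO_sub.exists_nonneg
  have hdiff : ∀ᶠ x in 𝓝 z, DifferentiableAt ℝ g x :=
    (hg.eventually (by simp)).mono fun x hx => hx.differentiableAt two_ne_zero
  obtain ⟨ρ, hρ, hball⟩ := Metric.eventually_nhds_iff_ball.1 (hbound.bound.and hdiff)
  refine Asymptotics.IsBigO.of_bound C ?_
  filter_upwards [Metric.ball_mem_nhds z hρ] with x hx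
  have hsub : Metric.closedBall z ‖x - z‖ ⊆ Metric.ball z ρ :=
    Metric.closedBall_subset_ball (mem_ball_iff_norm.1 hx)
  have hmean := (convex_closedBall z ‖x - z‖).norm_image_sub_le_of_norm_hasFDerivWithin_le'
    (f := g) (f' := fderiv ℝ g) (φ := fderiv ℝ g z) (C := C * ‖x - z‖) (x := z) (y := x)
    (fun y hy => (hball y (hsub hy)).2.hasFDerivAt.hasFDerivWithinAt)
    (fun y hy => (hball y (hsub hy)).1.trans
      (mul_le_mul_of_nonneg_left (mem_closedBall_iff_norm.1 hy) hC))
    (Metric.mem_closedBall_self (norm_nonneg _)) (mem_closedBall_iff_norm.2 le_rfl)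
  rwa [Real.norm_of_nonneg (by positivity), pow_two, ← mul_assoc]

/- Since `g z = 0`, the variation of `f` only enters multiplied by `g`, so that its
differentiability suffices. -/
theorem isBigO_clm_apply_sub {f : E → G →L[ℝ] W} {g : E → G} {z : E}
    (hf : DifferentiableAt ℝ f z) (hg : ContDiffAt ℝ 2 g z) (hgz : g z = 0) :
    (fun x => f x (g x) - f z (fderiv ℝ g z (x - z))) =O[𝓝 z] fun x => ‖x - z‖ ^ 2 := by
  have hquad := isBigO_sub_fderiv_of_contDiffAt hg
  have hlin := (hg.differentiableAt two_ne_zero).isBigO_sub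
  simp only [hgz, sub_zero] at hquad hlin
  have hprod : (fun x => (f x - f z) (g x)) =O[𝓝 z] fun x => ‖x - z‖ ^ 2 := by
    have hop : (fun x => (f x - f z) (g x)) =O[𝓝 z] fun x => ‖f x - f z‖ * ‖g x‖ :=
      Asymptotics.IsBigO.of_bound' (Eventually.of_forall fun x => by
        rw [Real.norm_of_nonneg (by positivity)]
        exact (f x - f z).le_opNorm _)
    simp only [pow_two]
    exact hop.trans (hf.isBigO_sub.norm_norm.mul hlin.norm_norm)
  refine ((((f z).isBigO_comp _ (𝓝 z)).trans hquad).add hprod).congr_left fun x => ?_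
  simp only [_root_.sub_apply, map_sub]
  abel

theorem hasStrictFDerivAt_of_isBigO {F : E → G} {S : E →L[ℝ] G} {z : E}
    (hF : ContDiffAt ℝ 1 F z)
    (h : (fun x => F x - F z - S (x - z)) =O[𝓝 z] fun x => ‖x - z‖ ^ 2) :
    HasStrictFDerivAt F S z :=
  hF.hasStrictFDerivAt' (.of_isLittleO
    (h.trans_isLittleO (Asymptotics.isLittleO_pow_sub_sub z one_lt_two))) one_ne_zero

theorem contDiff_flip {n : WithTop ℕ∞} :
    ContDiff ℝ n (ContinuousLinearMap.flip : (E →L[ℝ] G →L[ℝ] W) → G →L[ℝ] E →L[ℝ] W) :=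
  IsBoundedLinearMap.contDiff ⟨⟨fun _ _ => rfl, fun _ _ => rfl⟩, 1, one_pos, fun T => by
    rw [one_mul, ContinuousLinearMap.opNorm_flip]⟩

-- Unlike in `ContDiffAt.smul`, no `IsBoundedSMul` instance has to be found; instance search does
-- not find it on spaces of operators between duals.
theorem contDiffAt_smul {n : WithTop ℕ∞} {c : E → ℝ} {f : E → W} {z : E}
    (hc : ContDiffAt ℝ n c z) (hf : ContDiffAt ℝ n f z) : ContDiffAt ℝ n (fun x => c x • f x) z :=
  hc.smul hf

section Matrix

variable {ι : Type*} [Fintype ι] [DecidableEq ι] {n : WithTop ℕ∞} {A : E → Matrix ι ι ℝ} {z : E}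

theorem contDiffAt_matrix_det (hA : ∀ i j, ContDiffAt ℝ n (fun x => A x i j) z) :
    ContDiffAt ℝ n (fun x => (A x).det) z := by
  simp only [Matrix.det_apply, Units.smul_def, zsmul_eq_mul]
  exact ContDiffAt.sum fun σ _ => contDiffAt_const.mul (contDiffAt_prod fun k _ => hA _ _)

theorem contDiffAt_matrix_adjugate (hA : ∀ i j, ContDiffAt ℝ n (fun x => A x i j) z) (i j : ι) :
    ContDiffAt ℝ n (fun x => (A x).adjugate i j) z := by
  simp only [Matrix.adjugate_apply]
  refine contDiffAt_matrix_det fun k m => ?_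
  rcases eq_or_ne k j with rfl | hk
  · simpa using contDiffAt_const
  · simpa [Matrix.updateRow_ne hk] using hA k m

theorem contDiffAt_matrix_inv (hA : ∀ i j, ContDiffAt ℝ n (fun x => A x i j) z)
    (hz : (A z).det ≠ 0) (i j : ι) : ContDiffAt ℝ n (fun x => (A x)⁻¹ i j) z := by
  simp only [Matrix.inv_def, Ring.inverse_eq_inv', Matrix.smul_apply, smul_eq_mul]
  exact ((contDiffAt_matrix_det hA).inv hz).mul (contDiffAt_matrix_adjugate hA i j)

end Matrix

end Calculus

namespace ConstrainedEquation

variable {X : Type*} [NormedAddCommGroup X] [NormedSpace ℝ X]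
  {r : ℕ} (E : ConstrainedEquation X r) (M : AccelerationOperator X) {u : X}

section Smoothness

theorem contDiffAt_gram (hB : ∀ j, ContDiffAt ℝ 2 (E.B j) u) (i j : Fin r) :
    ContDiffAt ℝ 2 (fun x => E.gram M x i j) u :=
  (hB i).clm_apply (M.inv.contDiff.contDiffAt.comp u (hB j))

theorem eventually_gram_det_ne_zero (hB : ∀ j, ContDiffAt ℝ 2 (E.B j) u)
    (hG : (E.gram M u).det ≠ 0) : ∀ᶠ x in 𝓝 u, (E.gram M x).det ≠ 0 :=
  (contDiffAt_matrix_det (E.contDiffAt_gram M hB)).continuousAt.eventually_ne hG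

theorem contDiffAt_projB (hB : ∀ j, ContDiffAt ℝ 2 (E.B j) u) (hG : (E.gram M u).det ≠ 0) :
    ContDiffAt ℝ 2 (E.projB M) u := by
  refine ContDiffAt.sum fun i _ => ContDiffAt.sum fun j _ => ?_
  exact contDiffAt_smul (contDiffAt_matrix_inv (E.contDiffAt_gram M hB) hG i j)
    (((hB j).clm_comp contDiffAt_const).smulRight (hB i))

theorem contDiffAt_mu (hL : ContDiffAt ℝ 2 E.L00 u) (hB : ∀ j, ContDiffAt ℝ 2 (E.B j) u)
    (hG : (E.gram M u).det ≠ 0) (i : Fin r) : ContDiffAt ℝ 2 (fun x => E.mu M x i) u := by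
  simp only [mu, coeff, Matrix.mulVec, dotProduct]
  exact ContDiffAt.sum fun j _ => (contDiffAt_matrix_inv (E.contDiffAt_gram M hB) hG i j).mul
    ((hB j).clm_apply (M.inv.contDiff.contDiffAt.comp u hL))

theorem contDiffAt_L1_mu (hL : ContDiffAt ℝ 2 E.L00 u) (hB : ∀ j, ContDiffAt ℝ 2 (E.B j) u)
    (hG : (E.gram M u).det ≠ 0) : ContDiffAt ℝ 1 (fun x => E.L1 (E.mu M x) x) u := by
  have hdiff {g : X → StrongDual ℝ X} (hg : ContDiffAt ℝ 2 g u) :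
      ∀ᶠ x in 𝓝 u, DifferentiableAt ℝ g x :=
    (hg.eventually (by simp)).mono fun x hx => hx.differentiableAt two_ne_zero
  have hsum : ContDiffAt ℝ 1
      (fun x => fderiv ℝ E.L00 x - ∑ j, E.mu M x j • fderiv ℝ (E.B j) x) u :=
    (hL.fderiv_right (by norm_num)).sub (ContDiffAt.sum fun j _ =>
      ((E.contDiffAt_mu M hL hB hG j).of_le one_le_two).fun_smul
        ((hB j).fderiv_right (by norm_num)))
  refine hsum.congr_of_eventuallyEq ?_
  filter_upwards [hdiff hL, eventually_all.2 fun j => hdiff (hB j)] with x hLx hBx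
  exact L1_eq hLx hBx _

theorem contDiffAt_L0 (hL : ContDiffAt ℝ 2 E.L00 u) (hB : ∀ j, ContDiffAt ℝ 2 (E.B j) u)
    (μ : Fin r → ℝ) : ContDiffAt ℝ 2 (E.L0 μ) u :=
  hL.sub (ContDiffAt.sum fun j _ => contDiffAt_const.fun_smul (hB j))

/-- The operator `L₁† M⁻¹ (1 - B ⟨B, M⁻¹ B⟩⁻¹ ⟨B, M⁻¹ ·⟩)` at the iterate `x`, which the method
applies to `L₀ x`. -/
def residualOp (x : X) : StrongDual ℝ X →L[ℝ] StrongDual ℝ X :=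
  (E.L1adj (E.mu M x) x).comp (M.inv.comp (.id ℝ (StrongDual ℝ X) - E.projB M x))

/-- The operator `c ↦ c δQⱼ/δu` at the iterate `x`, which the method applies to `Qⱼ(x) - Cⱼ`. -/
def constraintOp (j : Fin r) (x : X) : ℝ →L[ℝ] StrongDual ℝ X :=
  (ContinuousLinearMap.id ℝ ℝ).smulRight (E.dQ j x)

/- The propagation constants `μ` are arbitrary because the projection annihilates `B`. With those of
the solitary wave, both `L₀` and `Qⱼ - Cⱼ` vanish there. -/
theorem step_eq {x : X} (hG : (E.gram M x).det ≠ 0) (μ : Fin r → ℝ) (h dt : ℝ) :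
    E.step M h dt x = x - dt • M.inv (E.residualOp M x (E.L0 μ x) +
      h • ∑ j, E.constraintOp j x (E.Q j x - E.C j)) := by
  rw [step, E.L0_mu M hG μ]
  rfl

theorem LQC_eq (hG : (E.gram M u).det ≠ 0) {μ : Fin r → ℝ} (h0 : E.L0 μ u = 0) (h : ℝ) (ψ : X) :
    E.LQC M h μ u ψ = -M.inv (E.residualOp M u (E.L1 μ u ψ) +
      h • ∑ j, E.constraintOp j u (E.dQ j u ψ)) := by
  have hneg (f g : StrongDual ℝ X) : M.inv (-f - g) = -M.inv (f + g) := by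
    rw [← map_neg, neg_add']
  rw [LQC_apply, ← projB_apply, residualOp, E.mu_eq_of_L0_eq_zero M hG h0]
  exact hneg _ _

theorem contDiffAt_residualOp (hL : ContDiffAt ℝ 2 E.L00 u)
    (hB : ∀ j, ContDiffAt ℝ 2 (E.B j) u) (hG : (E.gram M u).det ≠ 0) :
    ContDiffAt ℝ 1 (E.residualOp M) u := by
  have hadj : ContDiffAt ℝ 1 (fun x => E.L1adj (E.mu M x) x) u :=
    contDiff_flip.contDiffAt.comp u (E.contDiffAt_L1_mu M hL hB hG)
  exact hadj.clm_comp (contDiffAt_const.clm_comp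
    (contDiffAt_const.sub ((E.contDiffAt_projB M hB hG).of_le one_le_two)))

theorem contDiffAt_constraintOp {j : Fin r} (hQ : ContDiffAt ℝ 2 (E.Q j) u) :
    ContDiffAt ℝ 1 (E.constraintOp j) u :=
  contDiffAt_const.smulRight (hQ.fderiv_right (by norm_num))

theorem contDiffAt_step (hL : ContDiffAt ℝ 2 E.L00 u) (hB : ∀ j, ContDiffAt ℝ 2 (E.B j) u)
    (hQ : ∀ j, ContDiffAt ℝ 2 (E.Q j) u) (hG : (E.gram M u).det ≠ 0) (h dt : ℝ) :
    ContDiffAt ℝ 1 (E.step M h dt) u := by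
  have hres : ContDiffAt ℝ 1 (fun x => E.residualOp M x (E.L0 0 x)) u :=
    (E.contDiffAt_residualOp M hL hB hG).clm_apply ((E.contDiffAt_L0 hL hB 0).of_le one_le_two)
  have hcon : ContDiffAt ℝ 1 (fun x => ∑ j, E.constraintOp j x (E.Q j x - E.C j)) u :=
    ContDiffAt.sum fun j _ => (E.contDiffAt_constraintOp (hQ j)).clm_apply
      (((hQ j).of_le one_le_two).sub contDiffAt_const)
  have hstep : ContDiffAt ℝ 1 (fun x => x - dt • M.inv (E.residualOp M x (E.L0 0 x) +
      h • ∑ j, E.constraintOp j x (E.Q j x - E.C j))) u :=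
    contDiffAt_id.sub (contDiffAt_const.smul
      (M.inv.contDiff.contDiffAt.comp u (hres.add (contDiffAt_const.fun_smul hcon))))
  refine hstep.congr_of_eventuallyEq ?_
  filter_upwards [E.eventually_gram_det_ne_zero M hB hG] with x hx
  exact E.step_eq M hx 0 h dt

theorem isBigO_residualOp_sub (hL : ContDiffAt ℝ 2 E.L00 u)
    (hB : ∀ j, ContDiffAt ℝ 2 (E.B j) u) (hG : (E.gram M u).det ≠ 0) {μ : Fin r → ℝ}
    (h0 : E.L0 μ u = 0) :
    (fun x => E.residualOp M x (E.L0 μ x) - E.residualOp M u (E.L1 μ u (x - u)))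
      =O[𝓝 u] fun x => ‖x - u‖ ^ 2 :=
  isBigO_clm_apply_sub ((E.contDiffAt_residualOp M hL hB hG).differentiableAt one_ne_zero)
    (E.contDiffAt_L0 hL hB μ) h0

theorem isBigO_constraintOp_sub {j : Fin r} (hQ : ContDiffAt ℝ 2 (E.Q j) u)
    (hC : E.Q j u = E.C j) :
    (fun x => E.constraintOp j x (E.Q j x - E.C j) - E.constraintOp j u (E.dQ j u (x - u)))
      =O[𝓝 u] fun x => ‖x - u‖ ^ 2 := by
  simpa only [fderiv_sub_const] using! isBigO_clm_apply_sub
    ((E.contDiffAt_constraintOp hQ).differentiableAt one_ne_zero)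
    (hQ.sub (contDiffAt_const (c := E.C j))) (sub_eq_zero.2 hC)

end Smoothness

namespace IsNondegenerateWave

variable {E} {s : ℕ} {U : (Fin r → ℝ) × (Fin s → ℝ) → X} {μ₀ : Fin r → ℝ} {c₀ : Fin s → ℝ}

theorem step_eq_self (hW : E.IsNondegenerateWave U μ₀ c₀) (h dt : ℝ) :
    E.step M h dt (U (μ₀, c₀)) = U (μ₀, c₀) :=
  E.step_eq_self M (hW.gram_det_ne_zero M) hW.L0_eq_zero hW.Q_eq h dt

theorem isBigO_step_sub (hW : E.IsNondegenerateWave U μ₀ c₀) (h dt : ℝ) :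
    (fun x => E.step M h dt x - U (μ₀, c₀) -
      (1 + dt • E.LQC M h μ₀ (U (μ₀, c₀))) (x - U (μ₀, c₀)))
      =O[𝓝 (U (μ₀, c₀))] fun x => ‖x - U (μ₀, c₀)‖ ^ 2 := by
  set u := U (μ₀, c₀)
  have hG := hW.gram_det_ne_zero M
  have hres := E.isBigO_residualOp_sub M hW.contDiffAt_L00 hW.contDiffAt_B hG hW.L0_eq_zero
  have hcon := Asymptotics.IsBigO.fun_sum (s := Finset.univ) fun j _ =>
    E.isBigO_constraintOp_sub (hW.contDiffAt_Q j) (hW.Q_eq j)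
  refine (((-(dt • M.inv)).isBigO_comp _ (𝓝 u)).trans
    (hres.add (hcon.const_smul_left h))).congr' ?_ EventuallyEq.rfl
  filter_upwards [E.eventually_gram_det_ne_zero M hW.contDiffAt_B hG] with x hx
  rw [E.step_eq M hx μ₀, _root_.add_apply, one_apply_eq_self, _root_.smul_apply,
    E.LQC_eq M hG hW.L0_eq_zero]
  simp only [Pi.smul_apply, Finset.sum_sub_distrib, _root_.neg_apply, _root_.smul_apply, map_add,
    map_sub, map_smul]
  module

theorem hasStrictFDerivAt_step (hW : E.IsNondegenerateWave U μ₀ c₀) (h dt : ℝ) :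
    HasStrictFDerivAt (E.step M h dt) (1 + dt • E.LQC M h μ₀ (U (μ₀, c₀))) (U (μ₀, c₀)) :=
  hasStrictFDerivAt_of_isBigO (E.contDiffAt_step M hW.contDiffAt_L00 hW.contDiffAt_B
    hW.contDiffAt_Q (hW.gram_det_ne_zero M) h dt)
    (by simpa only [hW.step_eq_self M] using hW.isBigO_step_sub M h dt)

end IsNondegenerateWave

end ConstrainedEquation

/-! ### The energy space -/

section EnergySpace

variable {X : Type*} [NormedAddCommGroup X] [NormedSpace ℝ X]

/-- The energy space of `M`: the space `X` with the inner product `⟨M φ, ψ⟩`, whose norm is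
equivalent to that of `X`. It makes `𝓛_QC` self-adjoint. -/
def EnergySpace (_M : AccelerationOperator X) : Type _ := X

namespace EnergySpace

variable (M : AccelerationOperator X)

instance : AddCommGroup (EnergySpace M) := inferInstanceAs (AddCommGroup X)

instance : Module ℝ (EnergySpace M) := inferInstanceAs (Module ℝ X)

/-- The identity map onto the energy space, as a linear map. -/
def ofLinear : X ≃ₗ[ℝ] EnergySpace M := LinearEquiv.refl ℝ X

/-- The inner product `⟨M φ, ψ⟩` on `EnergySpace M`. -/
@[reducible] def core : InnerProductSpace.Core ℝ (EnergySpace M) where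
  inner φ ψ := M.op ((ofLinear M).symm φ) ((ofLinear M).symm ψ)
  conj_inner_symm φ ψ := M.hermitian _ _
  re_inner_nonneg φ := by
    rcases eq_or_ne ((ofLinear M).symm φ) 0 with hφ | hφ
    · simp [hφ]
    · exact (M.posDef _ hφ).le
  add_left φ ψ χ := by simp
  smul_left φ ψ c := by simp
  definite φ h := by
    by_contra hφ
    exact (M.posDef _ ((LinearEquiv.map_ne_zero_iff _).2 hφ)).ne' h

instance : NormedAddCommGroup (EnergySpace M) := (core M).toNormedAddCommGroup

instance : InnerProductSpace ℝ (EnergySpace M) := InnerProductSpace.ofCore (core M).toCore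

theorem inner_ofLinear (φ ψ : X) : inner ℝ (ofLinear M φ) (ofLinear M ψ) = M.op φ ψ := rfl

theorem norm_ofLinear_le (φ : X) :
    ‖ofLinear M φ‖ ≤ √‖(M.op : X →L[ℝ] StrongDual ℝ X)‖ * ‖φ‖ := by
  refine le_of_sq_le_sq ?_ (by positivity)
  rw [← real_inner_self_eq_norm_sq, inner_ofLinear, mul_pow, Real.sq_sqrt (by positivity), pow_two,
    ← mul_assoc]
  exact (le_abs_self _).trans ((M.op : X →L[ℝ] StrongDual ℝ X).le_opNorm₂ φ φ)

/- By the Cauchy-Schwarz inequality of the energy space, `‖M φ‖ ≤ √‖M‖ ‖φ‖_M`. -/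
theorem norm_le_norm_ofLinear (φ : X) :
    ‖φ‖ ≤ ‖M.inv‖ * √‖(M.op : X →L[ℝ] StrongDual ℝ X)‖ * ‖ofLinear M φ‖ := by
  have hop : ‖M.op φ‖ ≤ √‖(M.op : X →L[ℝ] StrongDual ℝ X)‖ * ‖ofLinear M φ‖ := by
    refine ContinuousLinearMap.opNorm_le_bound _ (by positivity) fun ψ => ?_
    calc ‖M.op φ ψ‖ ≤ ‖ofLinear M φ‖ * ‖ofLinear M ψ‖ :=
          norm_inner_le_norm (𝕜 := ℝ) (ofLinear M φ) (ofLinear M ψ)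
      _ ≤ ‖ofLinear M φ‖ * (√‖(M.op : X →L[ℝ] StrongDual ℝ X)‖ * ‖ψ‖) := by
          gcongr
          exact norm_ofLinear_le M ψ
      _ = _ := by ring
  calc ‖φ‖ = ‖M.inv (M.op φ)‖ := congrArg norm (M.op.symm_apply_apply φ).symm
    _ ≤ ‖M.inv‖ * ‖M.op φ‖ := M.inv.le_opNorm _
    _ ≤ ‖M.inv‖ * (√‖(M.op : X →L[ℝ] StrongDual ℝ X)‖ * ‖ofLinear M φ‖) := by gcongr
    _ = _ := (mul_assoc _ _ _).symm

/-- The identity map onto the energy space, as an isomorphism of topological vector spaces. -/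
def equiv : X ≃L[ℝ] EnergySpace M where
  toLinearEquiv := ofLinear M
  continuous_toFun := AddMonoidHomClass.continuous_of_bound (ofLinear M) _ (norm_ofLinear_le M)
  continuous_invFun := AddMonoidHomClass.continuous_of_bound (ofLinear M).symm _
    fun φ => norm_le_norm_ofLinear M ((ofLinear M).symm φ)

theorem inner_equiv (φ ψ : X) : inner ℝ (equiv M φ) (equiv M ψ) = M.op φ ψ := rfl

instance [CompleteSpace X] : CompleteSpace (EnergySpace M) :=
  (completeSpace_congr (e := (equiv M).toEquiv) (equiv M).isUniformEmbedding).1 inferInstance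

end EnergySpace

end EnergySpace

namespace ConstrainedEquation

variable {X : Type*} [NormedAddCommGroup X] [NormedSpace ℝ X] {r s : ℕ}
  {E : ConstrainedEquation X r} {U : (Fin r → ℝ) × (Fin s → ℝ) → X} {μ₀ : Fin r → ℝ}
  {c₀ : Fin s → ℝ}

theorem KernelIsInvarianceModes.exists_fderiv_eq
    (hker : E.KernelIsInvarianceModes U μ₀ c₀) {ψ : X} (hψ : ψ ∈ (E.L1 μ₀ (U (μ₀, c₀))).ker) :
    ∃ b, fderiv ℝ U (μ₀, c₀) (0, b) = ψ := by
  rw [hker, Submodule.mem_span_range_iff_exists_fun] at hψ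
  obtain ⟨b, rfl⟩ := hψ
  exact ⟨b, map_pi_eq_sum_smul_single
    ((fderiv ℝ U (μ₀, c₀)).comp (.inr ℝ (Fin r → ℝ) (Fin s → ℝ))) b⟩

namespace IsNondegenerateWave

variable {G : Type*} [NormedAddCommGroup G] [NormedSpace ℝ G] {P : X →L[ℝ] G}

theorem surjective_fderiv_family (hW : E.IsNondegenerateWave U μ₀ c₀)
    (hker : E.KernelIsInvarianceModes U μ₀ c₀)
    (hP : ∀ g, ∃ ψ ∈ (E.L1 μ₀ (U (μ₀, c₀))).ker, P ψ = g) :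
    Function.Surjective ((P.comp (fderiv ℝ U (μ₀, c₀))).prod
      (.pi fun j => (E.dQ j (U (μ₀, c₀))).comp (fderiv ℝ U (μ₀, c₀)))) := by
  rintro ⟨g, q⟩
  obtain ⟨a, rfl⟩ : ∃ a, E.dQdmu U μ₀ c₀ *ᵥ a = q :=
    Matrix.mulVec_surjective_iff_isUnit.2
      ((Matrix.isUnit_iff_isUnit_det _).2 (isUnit_iff_ne_zero.2 hW.det_ne_zero)) q
  obtain ⟨ψ, hψ, hPψ⟩ := hP (g - P (fderiv ℝ U (μ₀, c₀) (a, 0)))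
  obtain ⟨b, rfl⟩ := hker.exists_fderiv_eq hψ
  have hsplit : fderiv ℝ U (μ₀, c₀) (a, b) =
      fderiv ℝ U (μ₀, c₀) (a, 0) + fderiv ℝ U (μ₀, c₀) (0, b) := by
    rw [← map_add, Prod.mk_add_mk, add_zero, zero_add]
  refine ⟨(a, b), Prod.ext ?_ (funext fun i => ?_)⟩
  · exact (congrArg P hsplit).trans (by rw [map_add, hPψ, add_sub_cancel])
  · exact (congrArg (E.dQ i (U (μ₀, c₀))) hsplit).trans (by
      rw [map_add, hW.dQ_eq_zero i _ hψ, add_zero, ← hW.dQdmu_mulVec])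

theorem eventually_exists_solution (hW : E.IsNondegenerateWave U μ₀ c₀)
    (hker : E.KernelIsInvarianceModes U μ₀ c₀) [CompleteSpace G]
    (hP : ∀ g, ∃ ψ ∈ (E.L1 μ₀ (U (μ₀, c₀))).ker, P ψ = g)
    {N : Set ((Fin r → ℝ) × (Fin s → ℝ))} (hN : N ∈ 𝓝 (μ₀, c₀)) :
    ∀ᶠ x in 𝓝 (U (μ₀, c₀)), ∃ p ∈ N,
      E.L0 p.1 (U p) = 0 ∧ (∀ j, E.Q j (U p) = E.C j) ∧ P (U p) = P x := by
  have hU : HasStrictFDerivAt U (fderiv ℝ U (μ₀, c₀)) (μ₀, c₀) :=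
    hW.isSolutionFamily.1.hasStrictFDerivAt one_ne_zero
  have hPQ : HasStrictFDerivAt (fun p => (P (U p), fun j => E.Q j (U p))) _ (μ₀, c₀) :=
    (P.hasStrictFDerivAt.comp (μ₀, c₀) hU).prodMk (hasStrictFDerivAt_pi.2 fun j =>
      ((hW.contDiffAt_Q j).hasStrictFDerivAt two_ne_zero).comp (μ₀, c₀) hU)
  have himage := image_mem_map (m := fun p => (P (U p), fun j => E.Q j (U p)))
    (inter_mem hN hW.isSolutionFamily.2)
  rw [hPQ.map_nhds_eq_of_surj (LinearMap.range_eq_top.2 (hW.surjective_fderiv_family hker hP)),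
    funext hW.Q_eq] at himage
  have hcont : ContinuousAt (fun x => (P x, E.C)) (U (μ₀, c₀)) := by fun_prop
  filter_upwards [hcont himage] with x ⟨p, ⟨hpN, hp0⟩, hp⟩
  rw [Prod.mk.injEq] at hp
  exact ⟨p, hpN, hp0, congrFun hp.2, hp.1⟩

end IsNondegenerateWave

end ConstrainedEquation

/-! ### Convergence and divergence of the iteration -/

section Conjugation

variable {X Y : Type*} [NormedAddCommGroup X] [NormedSpace ℝ X] [NormedAddCommGroup Y]
  [NormedSpace ℝ Y] (e : X ≃L[ℝ] Y) {F : X → X} {S : X →L[ℝ] X} {u : X}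

theorem hasStrictFDerivAt_conj (hF : HasStrictFDerivAt F S u) :
    HasStrictFDerivAt (fun y => e (F (e.symm y))) (e.conjContinuousAlgEquiv S) (e u) := by
  have hF' : HasStrictFDerivAt F S (e.symm (e u)) := by rwa [e.symm_apply_apply]
  exact (e : X →L[ℝ] Y).hasStrictFDerivAt.comp (e u)
    (hF'.comp (e u) (e.symm : Y →L[ℝ] X).hasStrictFDerivAt)

theorem isBigO_conj (hF : (fun x => F x - u - S (x - u)) =O[𝓝 u] fun x => ‖x - u‖ ^ 2) :
    (fun y => e (F (e.symm y)) - e u - e.conjContinuousAlgEquiv S (y - e u))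
      =O[𝓝 (e u)] fun y => ‖y - e u‖ ^ 2 := by
  have hsymm : Tendsto e.symm (𝓝 (e u)) (𝓝 u) := by
    simpa using e.symm.continuous.tendsto (e u)
  have hsq : (fun y => ‖e.symm y - u‖ ^ 2) =O[𝓝 (e u)] fun y => ‖y - e u‖ ^ 2 := by
    simpa using (((e.symm : Y →L[ℝ] X).isBigO_comp (fun y => y - e u) (𝓝 (e u))).norm_norm.pow 2)
  refine (((e : X →L[ℝ] Y).isBigO_comp _ _).trans
    ((hF.comp_tendsto hsymm).trans hsq)).congr_left fun y => ?_
  simp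

theorem semiconj_conj : Function.Semiconj e F fun y => e (F (e.symm y)) := fun x =>
  congrArg (fun y => e (F y)) (e.symm_apply_apply x).symm

theorem trappedSet_preimage_conj (V : Set Y) :
    trappedSet F (e ⁻¹' V) = e ⁻¹' trappedSet (fun y => e (F (e.symm y))) V :=
  trappedSet_preimage_of_semiconj (semiconj_conj e) V

theorem conjContinuousAlgEquiv_one_add_smul (A : X →L[ℝ] X) (dt : ℝ) :
    e.conjContinuousAlgEquiv (1 + dt • A) = 1 + dt • e.conjContinuousAlgEquiv A := by
  rw [map_add, map_one, map_smul]

theorem one_add_smul_conj_pow_apply (A : X →L[ℝ] X) (dt : ℝ) (n : ℕ) (x : X) :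
    ((1 + dt • e.conjContinuousAlgEquiv A) ^ n) (e x) = e (((1 + dt • A) ^ n) x) := by
  rw [← conjContinuousAlgEquiv_one_add_smul, ← map_pow,
    ContinuousLinearEquiv.conjContinuousAlgEquiv_apply_apply, e.symm_apply_apply]

end Conjugation

namespace ConstrainedEquation

variable {X : Type*} [NormedAddCommGroup X] [NormedSpace ℝ X] {r s : ℕ}
  {E : ConstrainedEquation X r} {M : AccelerationOperator X} {h dt : ℝ} {μ : Fin r → ℝ} {u : X}

theorem divergesFrom_of_trappedSet_notMem_nhds {V : Set X} (hV : V ∈ 𝓝 u)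
    (h0 : trappedSet (E.step M h dt) V ∉ 𝓝 u) : E.DivergesFrom M h dt u := by
  obtain ⟨ε, hε, hball⟩ := Metric.mem_nhds_iff.1 hV
  refine ⟨ε, hε, fun δ hδ => ?_⟩
  by_contra! hstay
  refine h0 (mem_of_superset (Metric.ball_mem_nhds u hδ) fun x hx n => hball ?_)
  exact mem_ball_iff_norm.2 (hstay x (mem_ball_iff_norm.1 hx) n)

theorem divergesGenericallyFrom_of_interior_trappedSet_eq_empty {V : Set X} (hV : V ∈ 𝓝 u)
    (h0 : interior (trappedSet (E.step M h dt) V) = ∅) : E.DivergesGenericallyFrom M h dt u := by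
  obtain ⟨ε, hε, hball⟩ := Metric.mem_nhds_iff.1 hV
  refine ⟨ε, hε, Set.subset_empty_iff.1 (h0 ▸ interior_mono fun x hx n => hball ?_)⟩
  exact mem_ball_iff_norm.2 (hx n)

variable (E M h μ u) in
/-- The operator `𝓛_QC` on the energy space of `M`, where it is self-adjoint. -/
def energyLQC : EnergySpace M →L[ℝ] EnergySpace M :=
  (EnergySpace.equiv M).conjContinuousAlgEquiv (E.LQC M h μ u)

theorem energyLQC_equiv (x : X) :
    E.energyLQC M h μ u (EnergySpace.equiv M x) = EnergySpace.equiv M (E.LQC M h μ u x) := by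
  simp [energyLQC]

theorem inner_energyLQC_equiv (x y : X) :
    inner ℝ (E.energyLQC M h μ u (EnergySpace.equiv M x)) (EnergySpace.equiv M y) =
      M.op (E.LQC M h μ u x) y := by
  rw [energyLQC_equiv, EnergySpace.inner_equiv]

theorem spectrum_energyLQC :
    spectrum ℝ (E.energyLQC M h μ u) = spectrum ℝ (E.LQC M h μ u) :=
  AlgEquiv.spectrum_eq (EnergySpace.equiv M).conjContinuousAlgEquiv.toAlgEquiv _

theorem equiv_mem_ker_energyLQC {x : X} :
    EnergySpace.equiv M x ∈ (E.energyLQC M h μ u).ker ↔ x ∈ (E.LQC M h μ u).ker := by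
  simp [energyLQC_equiv]

theorem isPositive_neg_energyLQC [CompleteSpace X] (hG : (E.gram M u).det ≠ 0) (hh : 0 ≤ h) :
    (-E.energyLQC M h μ u).IsPositive := by
  refine (ContinuousLinearMap.isPositive_iff _).2 ⟨fun x y => ?_, fun x => ?_⟩
  · obtain ⟨x, rfl⟩ := (EnergySpace.equiv M).surjective x
    obtain ⟨y, rfl⟩ := (EnergySpace.equiv M).surjective y
    have hsymm := E.op_LQC_symm M hG h μ x y
    rw [← inner_energyLQC_equiv, ← EnergySpace.inner_equiv, ← energyLQC_equiv] at hsymm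
    simpa using hsymm
  · obtain ⟨x, rfl⟩ := (EnergySpace.equiv M).surjective x
    simpa [inner_energyLQC_equiv] using E.op_LQC_self_nonpos M hG hh μ x

namespace IsNondegenerateWave

variable {U : (Fin r → ℝ) × (Fin s → ℝ) → X} {μ₀ : Fin r → ℝ} {c₀ : Fin s → ℝ}

theorem equiv_mem_ker_energyLQC (hW : E.IsNondegenerateWave U μ₀ c₀) (hh : 0 < h) {x : X} :
    EnergySpace.equiv M x ∈ (E.energyLQC M h μ₀ (U (μ₀, c₀))).ker ↔
      x ∈ (E.L1 μ₀ (U (μ₀, c₀))).ker := by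
  rw [ConstrainedEquation.equiv_mem_ker_energyLQC, hW.ker_LQC M hh]

theorem hasStrictFDerivAt_conj_step (hW : E.IsNondegenerateWave U μ₀ c₀) (h dt : ℝ) :
    HasStrictFDerivAt
      (fun y => EnergySpace.equiv M (E.step M h dt ((EnergySpace.equiv M).symm y)))
      (1 + dt • E.energyLQC M h μ₀ (U (μ₀, c₀))) (EnergySpace.equiv M (U (μ₀, c₀))) := by
  rw [energyLQC, ← conjContinuousAlgEquiv_one_add_smul]
  exact hasStrictFDerivAt_conj _ (hW.hasStrictFDerivAt_step M h dt)

variable [CompleteSpace X]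

theorem isPositive_neg_energyLQC (hW : E.IsNondegenerateWave U μ₀ c₀) (hh : 0 ≤ h) :
    (-E.energyLQC M h μ₀ (U (μ₀, c₀))).IsPositive :=
  ConstrainedEquation.isPositive_neg_energyLQC (hW.gram_det_ne_zero M) hh

theorem isSelfAdjoint_energyLQC (hW : E.IsNondegenerateWave U μ₀ c₀) (hh : 0 ≤ h) :
    IsSelfAdjoint (E.energyLQC M h μ₀ (U (μ₀, c₀))) := by
  simpa using (hW.isPositive_neg_energyLQC (M := M) hh).isSelfAdjoint.neg

theorem exists_isLeast_spectrum_LQC (hW : E.IsNondegenerateWave U μ₀ c₀) (hr : 1 ≤ r)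
    (hh : 0 < h) : ∃ Λmin, IsLeast (spectrum ℝ (E.LQC M h μ₀ (U (μ₀, c₀)))) Λmin ∧ Λmin < 0 := by
  obtain ⟨ψ, hψ⟩ := hW.exists_op_LQC_neg M hr hh
  have hnt : Nontrivial (EnergySpace M) := ⟨EnergySpace.equiv M ψ, 0, fun h0 => by
    rw [map_eq_zero_iff _ (EnergySpace.equiv M).injective] at h0
    simp [h0] at hψ⟩
  have hsa := hW.isSelfAdjoint_energyLQC (M := M) hh.le
  obtain ⟨m, hm⟩ := exists_isLeast_spectrum hsa
  refine ⟨m, spectrum_energyLQC (E := E) ▸ hm, ?_⟩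
  by_contra! hm0
  have hle := le_inner_map_self_of_forall_le_spectrum hsa hm.2 (EnergySpace.equiv M ψ)
  rw [inner_energyLQC_equiv] at hle
  exact (hle.trans_lt hψ).not_ge (by positivity)

variable {Λmin : ℝ}

theorem exists_tendsto_one_add_smul_LQC_pow (hW : E.IsNondegenerateWave U μ₀ c₀) (hh : 0 < h)
    (hmin : IsLeast (spectrum ℝ (E.LQC M h μ₀ (U (μ₀, c₀)))) Λmin) (hneg : Λmin < 0)
    (hdt : 0 < dt) (hdt' : dt < -2 / Λmin) (w : X) :
    ∃ ψ ∈ (E.L1 μ₀ (U (μ₀, c₀))).ker,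
      Tendsto (fun n : ℕ => ((1 + dt • E.LQC M h μ₀ (U (μ₀, c₀))) ^ n) w) atTop (𝓝 ψ) := by
  rw [← spectrum_energyLQC] at hmin
  obtain ⟨k, hk, hlim⟩ := exists_tendsto_one_add_smul_pow (hW.isPositive_neg_energyLQC hh.le)
    hmin.2 hneg hdt hdt' (EnergySpace.equiv M w)
  obtain ⟨ψ, rfl⟩ := (EnergySpace.equiv M).surjective k
  refine ⟨ψ, (hW.equiv_mem_ker_energyLQC hh).1 hk, ?_⟩
  rw [(EnergySpace.equiv M).toHomeomorph.isInducing.tendsto_nhds_iff]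
  exact hlim.congr fun n => one_add_smul_conj_pow_apply _ _ dt n w

theorem eventually_exists_fixedPoint (hW : E.IsNondegenerateWave U μ₀ c₀)
    (hker : E.KernelIsInvarianceModes U μ₀ c₀) (hh : 0 < h) (dt : ℝ)
    {N : Set ((Fin r → ℝ) × (Fin s → ℝ))} (hN : N ∈ 𝓝 (μ₀, c₀)) :
    ∀ᶠ x in 𝓝 (U (μ₀, c₀)), ∃ p ∈ N,
      (E.L0 p.1 (U p) = 0 ∧ ∀ j, E.Q j (U p) = E.C j) ∧ E.step M h dt (U p) = U p ∧
      EnergySpace.equiv M x - EnergySpace.equiv M (U p) ∈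
        (E.energyLQC M h μ₀ (U (μ₀, c₀))).kerᗮ := by
  set K := (E.energyLQC M h μ₀ (U (μ₀, c₀))).ker
  let P : X →L[ℝ] K := K.orthogonalProjectionOnto.comp (EnergySpace.equiv M : X →L[ℝ] EnergySpace M)
  have hP (g : K) : ∃ ψ ∈ (E.L1 μ₀ (U (μ₀, c₀))).ker, P ψ = g := by
    obtain ⟨ψ, hψ⟩ := (EnergySpace.equiv M).surjective g
    refine ⟨ψ, (hW.equiv_mem_ker_energyLQC hh).1 (hψ ▸ g.2), ?_⟩
    exact (congrArg _ hψ).trans (K.orthogonalProjectionOnto_mem_subspace_eq_self g)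
  have hgram := hW.isSolutionFamily.1.continuousAt.eventually
    (E.eventually_gram_det_ne_zero M hW.contDiffAt_B (hW.gram_det_ne_zero M))
  filter_upwards [hW.eventually_exists_solution hker hP (inter_mem hN hgram)]
    with x ⟨p, ⟨hpN, hpG⟩, hp0, hpQ, hPx⟩
  refine ⟨p, hpN, ⟨hp0, hpQ⟩, E.step_eq_self M hpG hp0 hpQ h dt, ?_⟩
  rw [← map_sub, ← Submodule.orthogonalProjectionOnto_eq_zero_iff]
  exact (map_sub P x (U p)).trans (sub_eq_zero.2 hPx.symm)

theorem eventually_tendsto_iterate_step (hW : E.IsNondegenerateWave U μ₀ c₀)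
    (hker : E.KernelIsInvarianceModes U μ₀ c₀) (hh : 0 < h)
    (hmin : IsLeast (spectrum ℝ (E.LQC M h μ₀ (U (μ₀, c₀)))) Λmin) (hneg : Λmin < 0)
    (hdt : 0 < dt) (hdt' : dt < -2 / Λmin) {Λmax : ℝ} (hmax : Λmax < 0)
    (hgap : ∀ Λ ∈ spectrum ℝ (E.LQC M h μ₀ (U (μ₀, c₀))), Λ ≠ 0 → Λ ≤ Λmax)
    {N : Set ((Fin r → ℝ) × (Fin s → ℝ))} (hN : N ∈ 𝓝 (μ₀, c₀)) :
    ∀ᶠ x in 𝓝 (U (μ₀, c₀)), ∃ p ∈ N, E.L0 p.1 (U p) = 0 ∧ (∀ j, E.Q j (U p) = E.C j) ∧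
      Tendsto (fun n : ℕ => (E.step M h dt)^[n] x) atTop (𝓝 (U p)) := by
  set e := EnergySpace.equiv M
  rw [← spectrum_energyLQC] at hmin hgap
  obtain ⟨ρ, hρ0, hρ1, hcontr⟩ := exists_norm_one_add_smul_le
    (hW.isPositive_neg_energyLQC hh.le) hmin.2 hneg hdt hdt' hmax hgap
  let good : Set ((Fin r → ℝ) × (Fin s → ℝ)) :=
    {p | E.L0 p.1 (U p) = 0 ∧ ∀ j, E.Q j (U p) = E.C j}
  have hUe : Tendsto (fun p => e (U p)) (𝓝 (μ₀, c₀) ⊓ 𝓟 good) (𝓝 (e (U (μ₀, c₀)))) :=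
    (e.continuous.continuousAt.comp hW.isSolutionFamily.1.continuousAt).mono_left inf_le_left
  have hconv := eventually_tendsto_iterate_of_normally_contracting
    (hW.hasStrictFDerivAt_conj_step h dt) (by rw [e.symm_apply_apply, hW.step_eq_self])
    (fun y hy => one_add_smul_apply_mem_orthogonal_ker (hW.isSelfAdjoint_energyLQC hh.le) hy)
    hρ0 hρ1 hcontr hUe (fun W hW' => ?_) (inter_mem_inf hN (mem_principal_self good))
  · filter_upwards [e.continuous.continuousAt.eventually hconv] with x ⟨p, hp, hlim⟩
    refine ⟨p, hp.1, hp.2.1, hp.2.2, e.toHomeomorph.isInducing.tendsto_nhds_iff.2 ?_⟩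
    exact hlim.congr fun n => (((semiconj_conj e).iterate_right n) x).symm
  · rw [mem_inf_principal] at hW'
    rw [← e.map_nhds_eq, eventually_map]
    filter_upwards [hW.eventually_exists_fixedPoint (M := M) hker hh dt hW']
      with x ⟨p, hp, hgood, hfix, hperp⟩
    exact ⟨p, hp hgood, by rw [e.symm_apply_apply, hfix], hperp⟩

theorem convergesNear (hW : E.IsNondegenerateWave U μ₀ c₀)
    (hker : E.KernelIsInvarianceModes U μ₀ c₀) (hh : 0 < h)
    (hmin : IsLeast (spectrum ℝ (E.LQC M h μ₀ (U (μ₀, c₀)))) Λmin) (hneg : Λmin < 0)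
    (hdt : 0 < dt) (hdt' : dt < -2 / Λmin) {Λmax : ℝ} (hmax : Λmax < 0)
    (hgap : ∀ Λ ∈ spectrum ℝ (E.LQC M h μ₀ (U (μ₀, c₀))), Λ ≠ 0 → Λ ≤ Λmax) :
    E.ConvergesNear M h dt U μ₀ c₀ := by
  intro ε hε
  obtain ⟨δ, hδ, hball⟩ := Metric.eventually_nhds_iff_ball.1
    (hW.eventually_tendsto_iterate_step hker hh hmin hneg hdt hdt' hmax hgap
      (Metric.ball_mem_nhds (μ₀, c₀) hε))
  exact ⟨δ, hδ, fun u₀ hu₀ => (hball u₀ (mem_ball_iff_norm.2 hu₀)).imp fun p hp =>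
    ⟨mem_ball_iff_norm.1 hp.1, hp.2⟩⟩

theorem divergesFrom (hW : E.IsNondegenerateWave U μ₀ c₀) (hh : 0 < h)
    (hmin : Λmin ∈ spectrum ℝ (E.LQC M h μ₀ (U (μ₀, c₀)))) (hneg : Λmin < 0)
    (hdt : -2 / Λmin < dt) : E.DivergesFrom M h dt (U (μ₀, c₀)) := by
  have hsa : IsSelfAdjoint (1 + dt • E.energyLQC M h μ₀ (U (μ₀, c₀))) :=
    (IsSelfAdjoint.one _).add ((IsSelfAdjoint.all dt).smul (hW.isSelfAdjoint_energyLQC hh.le))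
  have hbigO := isBigO_conj (EnergySpace.equiv M) (hW.isBigO_step_sub M h dt)
  rw [conjContinuousAlgEquiv_one_add_smul] at hbigO
  rw [← spectrum_energyLQC] at hmin
  have := nontrivial_of_mem_spectrum hmin
  obtain ⟨V, hV, hescape⟩ := exists_trappedSet_notMem_nhds_of_one_lt_norm hbigO
    (one_lt_norm_one_add_smul hmin hneg hdt) (norm_pow_of_isSelfAdjoint hsa)
  refine divergesFrom_of_trappedSet_notMem_nhds
    ((EnergySpace.equiv M).continuous.continuousAt.preimage_mem_nhds hV) ?_
  rwa [trappedSet_preimage_conj, ← mem_map,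
    (EnergySpace.equiv M).map_nhds_eq]

theorem divergesGenericallyFrom (hW : E.IsNondegenerateWave U μ₀ c₀) (hh : 0 < h)
    (hmin : IsLeast (spectrum ℝ (E.LQC M h μ₀ (U (μ₀, c₀)))) Λmin) (hneg : Λmin < 0)
    (hdt : -2 / Λmin < dt) {Λ' : ℝ} (hΛ' : Λmin < Λ')
    (hgap : ∀ Λ ∈ spectrum ℝ (E.LQC M h μ₀ (U (μ₀, c₀))), Λ ≠ Λmin → Λ' ≤ Λ) :
    E.DivergesGenericallyFrom M h dt (U (μ₀, c₀)) := by
  rw [← spectrum_energyLQC] at hmin hgap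
  obtain ⟨V, hV, hthin⟩ := exists_interior_trappedSet_eq_empty_of_isolated
    (hW.isPositive_neg_energyLQC hh.le) hmin hneg hdt hΛ' hgap
    (hW.hasStrictFDerivAt_conj_step h dt)
  refine divergesGenericallyFrom_of_interior_trappedSet_eq_empty
    ((EnergySpace.equiv M).continuous.continuousAt.preimage_mem_nhds hV) ?_
  rw [trappedSet_preimage_conj]
  exact ((EnergySpace.equiv M).toHomeomorph.preimage_interior _).symm.trans (by rw [hthin]; rfl)

end IsNondegenerateWave

end ConstrainedEquation

end SolitaryWave

end

theorem theorem6 {X : Type*} [NormedAddCommGroup X] [NormedSpace ℝ X] [CompleteSpace X]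
    {r s : ℕ} (hr : 1 ≤ r)
    (E : SolitaryWave.ConstrainedEquation X r) (M : SolitaryWave.AccelerationOperator X)
    (h : ℝ) (hh : 0 < h)
    -- the solution family `U(μ; c)` and the solitary wave `u = U(μ₀; c₀)`
    (U : (Fin r → ℝ) × (Fin s → ℝ) → X) (μ₀ : Fin r → ℝ) (c₀ : Fin s → ℝ)
    (u : X) (hu : u = U (μ₀, c₀))
    (hU : E.IsSolutionFamily U μ₀ c₀)
    (hC : ∀ j, E.Q j u = E.C j)
    -- smoothness of the data near `u`
    (hL00 : ContDiffAt ℝ 2 E.L00 u) (hB : ∀ j, ContDiffAt ℝ 2 (E.B j) u)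
    (hQ : ∀ j, ContDiffAt ℝ 2 (E.Q j) u)
    -- the kernel of `L₁` consists of the invariance modes only
    (hker : E.KernelIsInvarianceModes U μ₀ c₀)
    -- each `δQⱼ/δu` is orthogonal to the kernel of `L₁`
    (horth : ∀ j, ∀ ψ ∈ (E.L1 μ₀ u).ker, E.dQ j u ψ = 0)
    (hdet : (E.dQdmu U μ₀ c₀).det ≠ 0) :
    ∃ Λmin : ℝ, IsLeast (spectrum ℝ (E.LQC M h μ₀ u)) Λmin ∧ Λmin < 0 ∧
      -- the linearized error iteration converges to an invariance mode
      (∀ dt : ℝ, 0 < dt → dt < -2 / Λmin → ∀ w : X, ∃ ψ ∈ (E.L1 μ₀ u).ker,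
        Tendsto (fun n : ℕ => ((1 + dt • E.LQC M h μ₀ u) ^ n) w) atTop (𝓝 ψ)) ∧
      -- convergence of the method, when zero is not an accumulation point of the spectrum
      ((∃ Λmax < 0, ∀ Λ ∈ spectrum ℝ (E.LQC M h μ₀ u), Λ ≠ 0 → Λ ≤ Λmax) →
        ∀ dt : ℝ, 0 < dt → dt < -2 / Λmin → E.ConvergesNear M h dt U μ₀ c₀) ∧
      -- divergence of the method
      (∀ dt : ℝ, -2 / Λmin < dt → E.DivergesFrom M h dt u) ∧
      -- generic divergence, when `Λmin` is an isolated point of the spectrum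
      ((∃ Λ' > Λmin, ∀ Λ ∈ spectrum ℝ (E.LQC M h μ₀ u), Λ ≠ Λmin → Λ' ≤ Λ) →
        ∀ dt : ℝ, -2 / Λmin < dt → E.DivergesGenericallyFrom M h dt u) := by
  subst hu
  have hW : E.IsNondegenerateWave U μ₀ c₀ := ⟨hU, hC, hL00, hB, hQ, horth, hdet⟩
  obtain ⟨Λmin, hmin, hneg⟩ := hW.exists_isLeast_spectrum_LQC (M := M) hr hh
  exact ⟨Λmin, hmin, hneg,
    fun dt hdt hdt' w => hW.exists_tendsto_one_add_smul_LQC_pow hh hmin hneg hdt hdt' w,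
    fun ⟨Λmax, hmax, hgap⟩ dt hdt hdt' => hW.convergesNear hker hh hmin hneg hdt hdt' hmax hgap,
    fun dt hdt => hW.divergesFrom hh hmin.1 hneg hdt,
    fun ⟨Λ', hΛ', hgap⟩ dt hdt => hW.divergesGenericallyFrom hh hmin hneg hdt hΛ' hgap⟩
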